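/- For $0\le k\le 1$ let $\mathrm{sn}(u,k)=\sin \mathrm{am}(u,k)$, $\mathrm{cn}(u,k)=\cos \mathrm{am}(u,k)$, $\mathrm{dn}(u,k)=\sqrt{1-k^2\,\mathrm{sn}^2(u,k)}$ be the Jacobi elliptic functions of a real variable $u$, where $\mathrm{am}(\cdot,k)$ is the inverse of $\varphi\mapsto\int_0^\varphi d\theta/\sqrt{1-k^2\sin^2\theta}$ (for $k=1$, of its restriction to $(-\pi/2,\pi/2)$). Consider the vector field $(yz,xz,xy)$ on $\mathbb{R}^3$ (that of the tetrahedral superflow), and the planar vector fields $$\Pi\bullet\Theta=\big(\beta\sqrt{1+\alpha^2},\ \alpha\sqrt{1+\alpha^2}\big)\ \text{ on } U=\mathbb{R}^2,\qquad \hat\Pi\bullet\hat\Theta=\Big(\alpha\beta,\ \alpha^2-\frac1{16\alpha^2}\Big)\ \text{ on } \hat U=\{(\alpha,\beta)\in\mathbb R^2:\alpha\neq0\}.$$ Let $S=\{x^2-y^2=1,\ x>0\}$, $\tau(x,y,z)=(y,z)$, $\tau^{-1}(\alpha,\beta)=(\sqrt{1+\alpha^2},\alpha,\beta)\in S$, and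 $\hat S=\{x^2-y^2=1\}$, $\hat\tau(x,y,z)=\big(\frac{x+y}2,z\big)$, $\hat\tau^{-1}(\alpha,\beta)=\big(\alpha+\frac1{4\alpha},\alpha-\frac1{4\alpha},\beta\big)\in \hat S$. Then for $(U,\Pi\bullet\Theta,S,\tau)$, and likewise for $(\hat U,\hat\Pi\bullet\hat\Theta,\hat S,\hat\tau)$, the following holds. 1. The vector field generates a flow: there are an open set $D\subset\mathbb{R}\times U$ and a map $F:D\to U$, $(t,p)\mapsto F(p,t)$, continuous, such that for each $p\in U$ the set $\{t:(t,p)\in D\}$ is an interval containing $0$, $F(p,0)=p$, $t\mapsto F(p,t)$ is an integral curve of the vector field, $F(p,t+s)=F(F(p,t),s)$ (for $(t,p)\in D$, one side being defined if and only if the other is), and every integral curve $\gamma$ in $U$, defined on an open interval $J\ni0$, satisfies $(t,\gamma(0))\in D$ and $F(\gamma(0),t)=\gamma(t)$ for $t\in J$. 2. This flow is the projection of the tetrahedral one: if $\gamma$ is an integral curve of $(yz,xz,xy)$ on an open interval $J\ni 0$ with $\gamma(0)\in S$, then $(t,\tau(\gamma(0)))\in D$ and $F(\tau(\gamma(0)),t)=\tau(\gamma(t))$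 for all $t\in J$. 3. It is not a projective flow: there is no map $\phi:\mathbb R^2\to\mathbb R^2$ such that for every $p\in U$ one has $F(p,t)=t^{-1}\phi(tp)$ for all sufficiently small $t\ne0$. 4. It is integrated explicitly in terms of Jacobi elliptic functions: let $p\in U$ and let $(x_0,y_0,z_0)=\tau^{-1}(p)$. Let $(X,Y,Z)$ be the functions $x,y,z$ ordered so that their initial values $a,b,c$ satisfy $a^2\ge b^2\ge c^2$: namely $(z,x,y)$ if $x_0^2\le z_0^2$, $(x,z,y)$ if $y_0^2\le z_0^2<x_0^2$, $(x,y,z)$ if $z_0^2<y_0^2$. Put $$\lambda=\sqrt{a^2-c^2}>0,\quad k=\sqrt{\frac{a^2-b^2}{a^2-c^2}}\in[0,1],\quad r=\frac cb\ \ (r=0\text{ if }b=c=0),$$ and, with $\mathrm{sn},\mathrm{cn},\mathrm{dn}$ taken at $(\lambda t,k)$, $$E=\mathrm{cn}-\frac{ra}{\lambda}\,\mathrm{sn}\,\mathrm{dn},\quad X(t)=\frac{a\,\mathrm{dn}-\lambda k^2 r\,\mathrm{sn}\,\mathrm{cn}}{E},\quad Y(t)=\frac{b\,(1-k^2r^2\,\mathrm{sn}^2)}{E},\quad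 Z(t)=\frac{c\,\mathrm{cn}\,\mathrm{dn}+\frac a\lambda(b-rc)\,\mathrm{sn}}{E}.$$ Then $(t,p)\in D$ if and only if $E$ has no zero on the closed interval between $0$ and $t$, and in that case $F(p,t)=\tau(x(t),y(t),z(t))$. -/

import Mathlib

open Set Filter Topology

noncomputable section

/-! ## Jacobi elliptic functions of a real argument, with modulus `0 ≤ k ≤ 1` -/

/-- The integrand `1 / √(1 - k² sin² θ)` of the elliptic integral of the first kind. -/
def ellipticIntegrand (k θ : ℝ) : ℝ := 1 / √(1 - k ^ 2 * Real.sin θ ^ 2)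

/-- The incomplete elliptic integral of the first kind
`F(φ, k) = ∫_0^φ dθ / √(1 - k² sin² θ)`. -/
def ellipticF (k φ : ℝ) : ℝ := ∫ θ in (0 : ℝ)..φ, ellipticIntegrand k θ

/-- The amplitudes `φ` for which the elliptic integral converges: all of `ℝ` if `0 ≤ k < 1`, and
the open interval `(-π/2, π/2)` if `k = 1`. -/
def ellipticDomain (k : ℝ) : Set ℝ :=
  {φ | IntervalIntegrable (ellipticIntegrand k) MeasureTheory.volume 0 φ}

/-- The Jacobi amplitude `am(u, k)`: the inverse function of `φ ↦ F(φ, k)`. -/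
def jacobiAm (k u : ℝ) : ℝ := Function.invFunOn (ellipticF k) (ellipticDomain k) u

/-- The Jacobi elliptic function `sn(u, k) = sin am(u, k)`. -/
def jacobiSn (k u : ℝ) : ℝ := Real.sin (jacobiAm k u)

/-- The Jacobi elliptic function `cn(u, k) = cos am(u, k)`. -/
def jacobiCn (k u : ℝ) : ℝ := Real.cos (jacobiAm k u)

/-- The Jacobi elliptic function `dn(u, k) = √(1 - k² sn²(u, k))`. -/
def jacobiDn (k u : ℝ) : ℝ := √(1 - k ^ 2 * jacobiSn k u ^ 2)

/-! ## Flows of vector fields -/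

section Flows

variable {E : Type*} [NormedAddCommGroup E] [NormedSpace ℝ E]

/-- `F`, defined on `D ⊆ ℝ × U`, is the (maximal, local) flow generated by the vector field `V`
on the open region `U`. Points of `D` are pairs (time, initial point). -/
structure IsFlowOfField (U : Set E) (V : E → E) (D : Set (ℝ × E)) (F : ℝ → E → E) : Prop where
  isOpen_phase : IsOpen U
  isOpen_domain : IsOpen D
  mem_phase : ∀ t p, (t, p) ∈ D → p ∈ U
  zero_mem : ∀ p ∈ U, ((0 : ℝ), p) ∈ D
  ordConnected : ∀ p, {t : ℝ | (t, p) ∈ D}.OrdConnected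
  continuousOn : ContinuousOn (fun q : ℝ × E => F q.1 q.2) D
  map_mem : ∀ t p, (t, p) ∈ D → F t p ∈ U
  map_zero : ∀ p ∈ U, F 0 p = p
  /-- the translation equation, including the domains of both sides -/
  add_mem_iff : ∀ t s p, (t, p) ∈ D → ((s, F t p) ∈ D ↔ (t + s, p) ∈ D)
  map_add : ∀ t s p, (t, p) ∈ D → (s, F t p) ∈ D → F (t + s) p = F s (F t p)
  /-- the flow moves along the vector field -/
  hasDerivAt : ∀ t p, (t, p) ∈ D → HasDerivAt (fun s => F s p) (V (F t p)) t
  /-- every solution of `γ' = V(γ)` in `U` is part of the flow -/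
  maximal : ∀ (J : Set ℝ) (γ : ℝ → E), IsOpen J → J.OrdConnected → (0 : ℝ) ∈ J →
    IsIntegralCurveOn γ (fun _ => V) J → (∀ t ∈ J, γ t ∈ U) →
    ∀ t ∈ J, (t, γ 0) ∈ D ∧ F t (γ 0) = γ t

/-- The local flow `F` on `U` comes from a projective flow: for some map `φ`, one has
`F(t, p) = t⁻¹ φ(t p)` for every `p ∈ U` and all small `t ≠ 0`. Nothing else is asked of `φ` (the
translation equation and the boundary condition `t⁻¹ φ(t p) → p` only reflect that `F` is a flow),
so that the negation of this property excludes all projective flows. -/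
def IsProjectiveFlowOn (U : Set E) (F : ℝ → E → E) : Prop :=
  ∃ φ : E → E, ∀ p ∈ U, ∀ᶠ t in 𝓝[≠] (0 : ℝ), F t p = t⁻¹ • φ (t • p)

end Flows

/-! ## The tetrahedral superflow and its two planar projections -/

/-- The vector field `yz • xz • xy` of the tetrahedral superflow. -/
def tetraField (q : ℝ × ℝ × ℝ) : ℝ × ℝ × ℝ := (q.2.1 * q.2.2, q.1 * q.2.2, q.1 * q.2.1)

/-- The flow `F` (with domain `D`) is the projection, by `τ`, of the flow of the tetrahedral
vector field on the invariant surface `S`: `F(t, τ(a)) = τ(γ(t))` for the trajectory `γ` of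
every `a ∈ S`. -/
def IsTetraProjection (S : Set (ℝ × ℝ × ℝ)) (τ : ℝ × ℝ × ℝ → ℝ × ℝ)
    (D : Set (ℝ × (ℝ × ℝ))) (F : ℝ → ℝ × ℝ → ℝ × ℝ) : Prop :=
  ∀ (J : Set ℝ) (γ : ℝ → ℝ × ℝ × ℝ), IsOpen J → J.OrdConnected → (0 : ℝ) ∈ J →
    IsIntegralCurveOn γ (fun _ => tetraField) J → γ 0 ∈ S →
    ∀ t ∈ J, (t, τ (γ 0)) ∈ D ∧ F t (τ (γ 0)) = τ (γ t)

/-- The field `Π • Θ = β √(1 + α²) • α √(1 + α²)` on the plane. -/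
def fieldPiTheta (p : ℝ × ℝ) : ℝ × ℝ := (p.2 * √(1 + p.1 ^ 2), p.1 * √(1 + p.1 ^ 2))

/-- The field `Π̂ • Θ̂ = αβ • α² - 1 / (16 α²)` on the plane without the line `α = 0`. -/
def fieldPiThetaHat (p : ℝ × ℝ) : ℝ × ℝ := (p.1 * p.2, p.1 ^ 2 - 1 / (16 * p.1 ^ 2))

/-- One component `x² - y² = 1`, `x > 0` of the hyperbolic cylinder. -/
def halfCylinder : Set (ℝ × ℝ × ℝ) := {q | q.1 ^ 2 - q.2.1 ^ 2 = 1 ∧ 0 < q.1}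

/-- The hyperbolic cylinder `x² - y² = 1`. -/
def fullCylinder : Set (ℝ × ℝ × ℝ) := {q | q.1 ^ 2 - q.2.1 ^ 2 = 1}

/-- Orthogonal projection to the plane `x = 0`. -/
def projYZ (q : ℝ × ℝ × ℝ) : ℝ × ℝ := (q.2.1, q.2.2)

/-- Orthogonal projection to the plane `x = y`, in which `(α, α, β)` has coordinates `(α, β)`. -/
def projDiag (q : ℝ × ℝ × ℝ) : ℝ × ℝ := ((q.1 + q.2.1) / 2, q.2.2)

/-- The point of the half-cylinder above `(α, β)`. -/
def liftYZ (p : ℝ × ℝ) : ℝ × ℝ × ℝ := (√(1 + p.1 ^ 2), p.1, p.2)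

/-- The point of the cylinder above `(α, β)`, `α ≠ 0`. -/
def liftDiag (p : ℝ × ℝ) : ℝ × ℝ × ℝ := (p.1 + 1 / (4 * p.1), p.1 - 1 / (4 * p.1), p.2)

/-! ## Explicit solutions

For the initial values `a`, `b`, `c` of three functions with `A' = BC`, `B' = AC`, `C' = AB`,
where `a² ≥ b² ≥ c²` and `a² > c²`, put `lam = √(a² - c²)`, `k = √((a² - b²) / (a² - c²))`,
`r = c / b` (and `r = 0` if `b = c = 0`, which is the value of `c / b` in Lean). -/

def solLam (a c : ℝ) : ℝ := √(a ^ 2 - c ^ 2)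

def solMod (a b c : ℝ) : ℝ := √((a ^ 2 - b ^ 2) / (a ^ 2 - c ^ 2))

/-- The common denominator `cn - (r a / lam) sn dn`. -/
def solDen (a b c t : ℝ) : ℝ :=
  jacobiCn (solMod a b c) (solLam a c * t)
    - c / b * a / solLam a c
      * (jacobiSn (solMod a b c) (solLam a c * t) * jacobiDn (solMod a b c) (solLam a c * t))

/-- `A(t) = (a dn - lam k² r sn cn) / den`. -/
def solMax (a b c t : ℝ) : ℝ :=
  (a * jacobiDn (solMod a b c) (solLam a c * t)
    - solLam a c * solMod a b c ^ 2 * (c / b)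
      * (jacobiSn (solMod a b c) (solLam a c * t) * jacobiCn (solMod a b c) (solLam a c * t)))
  / solDen a b c t

/-- `B(t) = b (1 - k² r² sn²) / den`. -/
def solMid (a b c t : ℝ) : ℝ :=
  b * (1 - solMod a b c ^ 2 * (c / b) ^ 2 * jacobiSn (solMod a b c) (solLam a c * t) ^ 2)
  / solDen a b c t

/-- `C(t) = (c cn dn + (a / lam) (b - r c) sn) / den`. -/
def solMin (a b c t : ℝ) : ℝ :=
  (c * (jacobiCn (solMod a b c) (solLam a c * t) * jacobiDn (solMod a b c) (solLam a c * t))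
    + a / solLam a c * (b - c / b * c) * jacobiSn (solMod a b c) (solLam a c * t))
  / solDen a b c t

/-- The denominator of the solution of `x' = yz`, `y' = xz`, `z' = xy` with initial point
`q = (x₀, y₀, z₀)`, `y₀² < x₀²`; the initial values are put in decreasing order of squares. -/
def tetraDen (q : ℝ × ℝ × ℝ) (t : ℝ) : ℝ :=
  if q.1 ^ 2 ≤ q.2.2 ^ 2 then solDen q.2.2 q.1 q.2.1 t
  else if q.2.1 ^ 2 ≤ q.2.2 ^ 2 then solDen q.1 q.2.2 q.2.1 t
  else solDen q.1 q.2.1 q.2.2 t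

/-- The solution of `x' = yz`, `y' = xz`, `z' = xy` with initial point `q = (x₀, y₀, z₀)`,
`y₀² < x₀²`, in terms of the Jacobi elliptic functions. -/
def tetraSol (q : ℝ × ℝ × ℝ) (t : ℝ) : ℝ × ℝ × ℝ :=
  if q.1 ^ 2 ≤ q.2.2 ^ 2 then
    (solMid q.2.2 q.1 q.2.1 t, solMin q.2.2 q.1 q.2.1 t, solMax q.2.2 q.1 q.2.1 t)
  else if q.2.1 ^ 2 ≤ q.2.2 ^ 2 then
    (solMax q.1 q.2.2 q.2.1 t, solMin q.1 q.2.2 q.2.1 t, solMid q.1 q.2.2 q.2.1 t)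
  else
    (solMax q.1 q.2.1 q.2.2 t, solMid q.1 q.2.1 q.2.2 t, solMin q.1 q.2.1 q.2.2 t)

/-- The flow `F` on `U` (with domain `D`) is given by projecting, by `τ`, the explicit solution
in Jacobi elliptic functions that starts at the lift of the initial point; the existence interval
of a trajectory is the largest interval around `0` on which the denominator does not vanish. -/
def IsExplicitJacobiFlow (U : Set (ℝ × ℝ)) (lift : ℝ × ℝ → ℝ × ℝ × ℝ)
    (τ : ℝ × ℝ × ℝ → ℝ × ℝ) (D : Set (ℝ × (ℝ × ℝ))) (F : ℝ → ℝ × ℝ → ℝ × ℝ) : Prop :=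
  D = {q | q.2 ∈ U ∧ ∀ s ∈ uIcc 0 q.1, tetraDen (lift q.2) s ≠ 0} ∧
  ∀ t p, (t, p) ∈ D → F t p = τ (tetraSol (lift p) t)

end

/-!
For a `C¹` vector field `V` on an open set `U`, the maximal solutions of `γ' = V(γ)` form a flow in
the sense of `IsFlowOfField` (`isFlowOfField_maximalFlow`). Picard–Lindelöf gives existence and
joint continuity on a box around each `(0, q)`; along a trajectory, any two nearby times differ by
such a box, so openness of the domain and continuity of the flow spread over the whole (connected)
interval of existence (`continuousAt_maximalFlow`).

The function `x² - y²` is a first integral of the tetrahedral field, and both planar regions are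
charts, via `τ` and its inverse, of the invariant surface `x² - y² = 1` or of the half with `x > 0`;
in these charts the tetrahedral field becomes the planar field (`IsTetraChart`). Hence `τ` maps
tetrahedral trajectories to trajectories of the planar flow.

The amplitude satisfies `am' = dn` for all `0 ≤ k ≤ 1`; for `k < 1` the elliptic integral is an
increasing bijection of `ℝ`, while for `k = 1` it converges exactly on `(-π/2, π/2)` and its inverse
is the Gudermannian function `arctan ∘ sinh`. This gives the derivatives of `sn`, `cn`, `dn`, and
that the explicit quotients solve the tetrahedral system then becomes a polynomial identity modulo
`sn² + cn² = 1`, `dn² = 1 - k² sn²` and the relations between the parameters (`hasDerivAt_sol`).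
They therefore give the flow up to the first zero of the common denominator. The flow does not reach
that zero, because the numerator of the middle function `B` does not vanish there
(`solMidNum_ne_zero`), so that `B` has a pole.

Finally, a projective flow is generated by a field that is homogeneous of degree two
(`IsProjectiveFlowOn.field_smul`), and neither planar field is: compare the points `(1, 0)` and
`(2, 0)`.
-/

/-! ### The maximal local flow of a `C¹` vector field -/

section MaximalFlow

variable {E : Type*} [NormedAddCommGroup E] [NormedSpace ℝ E]

/-- Two integral curves of an autonomous `C¹` vector field that meet at one time agree on the
whole of their common open interval. -/
theorem IsIntegralCurveOn.eqOn_of_contDiffAt {U : Set E} {V : E → E}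
    (hV : ∀ p ∈ U, ContDiffAt ℝ 1 V p) {J : Set ℝ} (hJ : IsOpen J) (hJc : J.OrdConnected)
    {γ₁ γ₂ : ℝ → E} (h₁ : IsIntegralCurveOn γ₁ (fun _ => V) J)
    (h₂ : IsIntegralCurveOn γ₂ (fun _ => V) J) (hU : ∀ t ∈ J, γ₁ t ∈ U) {t₀ : ℝ} (ht₀ : t₀ ∈ J)
    (h : γ₁ t₀ = γ₂ t₀) : EqOn γ₁ γ₂ J := by
  have hd₁ : ∀ t ∈ J, HasDerivAt γ₁ (V (γ₁ t)) t := fun t ht =>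
    (h₁ t ht).hasDerivAt (hJ.mem_nhds ht)
  have hd₂ : ∀ t ∈ J, HasDerivAt γ₂ (V (γ₂ t)) t := fun t ht =>
    (h₂ t ht).hasDerivAt (hJ.mem_nhds ht)
  have loc : ∀ t ∈ J, γ₁ t = γ₂ t → γ₁ =ᶠ[𝓝 t] γ₂ := by
    intro t ht he
    obtain ⟨K, s, hs, hl⟩ := (hV _ (hU t ht)).exists_lipschitzOnWith
    refine ODE_solution_unique_of_eventually (v := fun _ => V) (s := fun _ => s) (K := K)
      (Eventually.of_forall fun _ => hl) ?_ ?_ he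
    · filter_upwards [hJ.mem_nhds ht, (hd₁ t ht).continuousAt hs] with r hr hr'
      exact ⟨hd₁ r hr, hr'⟩
    · rw [he] at hs
      filter_upwards [hJ.mem_nhds ht, (hd₂ t ht).continuousAt hs] with r hr hr'
      exact ⟨hd₂ r hr, hr'⟩
  have key : J ⊆ {t | γ₁ =ᶠ[𝓝 t] γ₂} := by
    refine hJc.isPreconnected.subset_of_closure_inter_subset isOpen_setOfPred_eventually_nhds
      ⟨t₀, ht₀, loc t₀ ht₀ h⟩ ?_
    rintro t ⟨htc, ht⟩
    refine loc t ht ?_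
    have hfr : ∃ᶠ r in 𝓝 t, γ₁ r = γ₂ r :=
      (mem_closure_iff_frequently.1 htc).mono fun r hr => hr.self_of_nhds
    by_contra hne
    exact hfr (((hd₁ t ht).continuousAt.ne_iff_eventually_ne (hd₂ t ht).continuousAt).1 hne)
  exact fun t ht => (key ht).self_of_nhds

/-- The pairs `(t, p)` such that the solution of `γ' = V(γ)` in `U` with `γ(0) = p` exists up to
time `t`. -/
def maximalFlowDomain (U : Set E) (V : E → E) : Set (ℝ × E) :=
  {q | ∃ (J : Set ℝ) (γ : ℝ → E), IsOpen J ∧ J.OrdConnected ∧ 0 ∈ J ∧ q.1 ∈ J ∧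
    IsIntegralCurveOn γ (fun _ => V) J ∧ γ 0 = q.2 ∧ ∀ s ∈ J, γ s ∈ U}

open Classical in
/-- The value at time `t` of the solution of `γ' = V(γ)` in `U` with `γ(0) = p`, set to `p` outside
the domain of the flow. -/
noncomputable def maximalFlow (U : Set E) (V : E → E) (t : ℝ) (p : E) : E :=
  if h : (t, p) ∈ maximalFlowDomain U V then h.choose_spec.choose t else p

variable {U : Set E} {V : E → E}

theorem maximalFlow_eq (hV : ∀ p ∈ U, ContDiffAt ℝ 1 V p) {J : Set ℝ} {γ : ℝ → E}
    (hJ : IsOpen J) (hJc : J.OrdConnected) (h0 : 0 ∈ J)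
    (hγ : IsIntegralCurveOn γ (fun _ => V) J) (hU : ∀ t ∈ J, γ t ∈ U) {t : ℝ} (ht : t ∈ J) :
    (t, γ 0) ∈ maximalFlowDomain U V ∧ maximalFlow U V t (γ 0) = γ t := by
  have hD : (t, γ 0) ∈ maximalFlowDomain U V := ⟨J, γ, hJ, hJc, h0, ht, hγ, rfl, hU⟩
  refine ⟨hD, ?_⟩
  rw [maximalFlow, dif_pos hD]
  obtain ⟨hJ', hJc', h0', ht', hγ', hp', hU'⟩ := hD.choose_spec.choose_spec
  exact IsIntegralCurveOn.eqOn_of_contDiffAt hV (hJ'.inter hJ) (hJc'.inter hJc)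
    (hγ'.mono inter_subset_left) (hγ.mono inter_subset_right) (fun s hs => hU' s hs.1)
    ⟨h0', h0⟩ hp' ⟨ht', ht⟩

theorem isOpen_maximalFlowDomain_time (U : Set E) (V : E → E) (p : E) :
    IsOpen {t : ℝ | (t, p) ∈ maximalFlowDomain U V} := by
  rw [isOpen_iff_mem_nhds]
  rintro t ⟨J, γ, hJ, hJc, h0, ht, hγ, hp, hU⟩
  filter_upwards [hJ.mem_nhds ht] with s hs
  exact ⟨J, γ, hJ, hJc, h0, hs, hγ, hp, hU⟩

theorem ordConnected_maximalFlowDomain_time (U : Set E) (V : E → E) (p : E) :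
    {t : ℝ | (t, p) ∈ maximalFlowDomain U V}.OrdConnected := by
  refine IsPreconnected.ordConnected (isPreconnected_of_forall 0 ?_)
  rintro t ⟨J, γ, hJ, hJc, h0, ht, hγ, hp, hU⟩
  exact ⟨J, fun s hs => ⟨J, γ, hJ, hJc, h0, hs, hγ, hp, hU⟩, h0, ht, hJc.isPreconnected⟩

theorem hasDerivAt_maximalFlow (hV : ∀ p ∈ U, ContDiffAt ℝ 1 V p) {t : ℝ} {p : E}
    (h : (t, p) ∈ maximalFlowDomain U V) :
    HasDerivAt (fun s => maximalFlow U V s p) (V (maximalFlow U V t p)) t := by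
  obtain ⟨J, γ, hJ, hJc, h0, ht, hγ, rfl, hU⟩ := h
  have he : ∀ s ∈ J, maximalFlow U V s (γ 0) = γ s := fun s hs =>
    (maximalFlow_eq hV hJ hJc h0 hγ hU hs).2
  rw [he t ht]
  refine ((hγ t ht).hasDerivAt (hJ.mem_nhds ht)).congr_of_eventuallyEq ?_
  filter_upwards [hJ.mem_nhds ht] with s hs using he s hs

theorem maximalFlow_mem (hV : ∀ p ∈ U, ContDiffAt ℝ 1 V p) {t : ℝ} {p : E}
    (h : (t, p) ∈ maximalFlowDomain U V) : maximalFlow U V t p ∈ U := by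
  obtain ⟨J, γ, hJ, hJc, h0, ht, hγ, rfl, hU⟩ := h
  exact (maximalFlow_eq hV hJ hJc h0 hγ hU ht).2 ▸ hU t ht

theorem mem_of_mem_maximalFlowDomain {t : ℝ} {p : E}
    (h : (t, p) ∈ maximalFlowDomain U V) : p ∈ U := by
  obtain ⟨J, γ, -, -, h0, -, -, rfl, hU⟩ := h
  exact hU 0 h0

theorem zero_mem_of_mem_maximalFlowDomain {t : ℝ} {p : E}
    (h : (t, p) ∈ maximalFlowDomain U V) : ((0 : ℝ), p) ∈ maximalFlowDomain U V := by
  obtain ⟨J, γ, hJ, hJc, h0, ht, hγ, hp, hU⟩ := h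
  exact ⟨J, γ, hJ, hJc, h0, h0, hγ, hp, hU⟩

theorem maximalFlow_zero (hV : ∀ p ∈ U, ContDiffAt ℝ 1 V p) {t : ℝ} {p : E}
    (h : (t, p) ∈ maximalFlowDomain U V) : maximalFlow U V 0 p = p := by
  obtain ⟨J, γ, hJ, hJc, h0, ht, hγ, rfl, hU⟩ := h
  exact (maximalFlow_eq hV hJ hJc h0 hγ hU h0).2

theorem maximalFlow_isIntegralCurveOn (hV : ∀ p ∈ U, ContDiffAt ℝ 1 V p) (p : E) :
    IsIntegralCurveOn (fun s => maximalFlow U V s p) (fun _ => V)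
      {t : ℝ | (t, p) ∈ maximalFlowDomain U V} :=
  fun _ ht => (hasDerivAt_maximalFlow hV ht).hasDerivWithinAt

/-- A solution of an autonomous equation stays a solution when time is translated. -/
theorem maximalFlow_sub (hV : ∀ p ∈ U, ContDiffAt ℝ 1 V p) {t s : ℝ} {p : E}
    (ht : (t, p) ∈ maximalFlowDomain U V) (hs : (t + s, p) ∈ maximalFlowDomain U V) :
    (s, maximalFlow U V t p) ∈ maximalFlowDomain U V ∧
      maximalFlow U V s (maximalFlow U V t p) = maximalFlow U V (t + s) p := by
  have := maximalFlow_eq hV (J := (fun r => t + r) ⁻¹' {t : ℝ | (t, p) ∈ maximalFlowDomain U V})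
    (γ := fun r => maximalFlow U V (t + r) p)
    ((isOpen_maximalFlowDomain_time U V p).preimage (by fun_prop))
    ((ordConnected_maximalFlowDomain_time U V p).preimage_mono
      (fun a b hab => by simpa using hab)) (by simpa using ht)
    (fun r hr => ((hasDerivAt_maximalFlow hV hr).comp_const_add t r).hasDerivWithinAt)
    (fun r hr => maximalFlow_mem hV hr) (t := s) hs
  simpa using this

/-- The solution through `p` up to time `t` can be continued by the solution through the point
that it reaches at time `t`. -/
theorem add_mem_maximalFlowDomain (hV : ∀ p ∈ U, ContDiffAt ℝ 1 V p) {t s : ℝ} {p : E}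
    (ht : (t, p) ∈ maximalFlowDomain U V)
    (hs : (s, maximalFlow U V t p) ∈ maximalFlowDomain U V) :
    (t + s, p) ∈ maximalFlowDomain U V := by
  classical
  set q := maximalFlow U V t p with hq
  set J₁ : Set ℝ := {r : ℝ | (r, p) ∈ maximalFlowDomain U V} with hJ₁
  set J₂ : Set ℝ := (fun r => -t + r) ⁻¹' {r : ℝ | (r, q) ∈ maximalFlowDomain U V} with hJ₂
  have o₁ : IsOpen J₁ := isOpen_maximalFlowDomain_time U V p
  have o₂ : IsOpen J₂ := (isOpen_maximalFlowDomain_time U V q).preimage (by fun_prop)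
  have c₁ : J₁.OrdConnected := ordConnected_maximalFlowDomain_time U V p
  have c₂ : J₂.OrdConnected := (ordConnected_maximalFlowDomain_time U V q).preimage_mono
      (fun a b hab => by simpa using hab)
  have t₂ : t ∈ J₂ := by simpa [hJ₂] using zero_mem_of_mem_maximalFlowDomain hs
  have i₁ : IsIntegralCurveOn (fun r => maximalFlow U V r p) (fun _ => V) J₁ :=
    maximalFlow_isIntegralCurveOn hV p
  have i₂ : IsIntegralCurveOn (fun r => maximalFlow U V (-t + r) q) (fun _ => V) J₂ :=
    fun r hr => ((hasDerivAt_maximalFlow hV hr).comp_const_add (-t) r).hasDerivWithinAt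
  have heq : EqOn (fun r => maximalFlow U V r p) (fun r => maximalFlow U V (-t + r) q)
      (J₁ ∩ J₂) :=
    IsIntegralCurveOn.eqOn_of_contDiffAt hV (o₁.inter o₂) (c₁.inter c₂)
      (i₁.mono inter_subset_left) (i₂.mono inter_subset_right)
      (fun r hr => maximalFlow_mem hV hr.1) ⟨ht, t₂⟩
      (by simpa using hq.symm.trans (maximalFlow_zero hV hs).symm)
  set γ : ℝ → E := J₁.piecewise (fun r => maximalFlow U V r p)
    (fun r => maximalFlow U V (-t + r) q) with hγ
  have e₁ : EqOn γ (fun r => maximalFlow U V r p) J₁ := piecewise_eqOn _ _ _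
  have e₂ : EqOn γ (fun r => maximalFlow U V (-t + r) q) J₂ := by
    intro r hr
    by_cases hr₁ : r ∈ J₁
    · exact (e₁ hr₁).trans (heq ⟨hr₁, hr⟩)
    · exact piecewise_eq_of_notMem _ _ _ hr₁
  have h0 : (0 : ℝ) ∈ J₁ := zero_mem_of_mem_maximalFlowDomain ht
  refine ⟨J₁ ∪ J₂, γ, o₁.union o₂, ?_, Or.inl h0, Or.inr ?_, ?_, ?_, ?_⟩
  · exact (c₁.isPreconnected.union t ht t₂ c₂.isPreconnected).ordConnected
  · simpa [hJ₂] using hs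
  · rintro r (hr | hr)
    · have := (i₁ r hr).hasDerivAt (o₁.mem_nhds hr)
      simp only [← e₁ hr] at this
      exact (this.congr_of_eventuallyEq (e₁.eventuallyEq_of_mem (o₁.mem_nhds hr))).hasDerivWithinAt
    · have := (i₂ r hr).hasDerivAt (o₂.mem_nhds hr)
      simp only [← e₂ hr] at this
      exact (this.congr_of_eventuallyEq (e₂.eventuallyEq_of_mem (o₂.mem_nhds hr))).hasDerivWithinAt
  · exact (e₁ h0).trans (maximalFlow_zero hV ht)
  · rintro r (hr | hr)
    · rw [e₁ hr]; exact maximalFlow_mem hV hr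
    · rw [e₂ hr]; exact maximalFlow_mem hV hr

variable [CompleteSpace E]

/-- Picard–Lindelöf: the flow is defined and jointly continuous on a box around `(0, q)`. -/
theorem exists_box_subset_maximalFlowDomain (hUo : IsOpen U)
    (hV : ∀ p ∈ U, ContDiffAt ℝ 1 V p) {q : E} (hq : q ∈ U) :
    ∃ ε > (0 : ℝ), ∃ W : Set E, IsOpen W ∧ q ∈ W ∧
      Ioo (-ε) ε ×ˢ W ⊆ maximalFlowDomain U V ∧
      ContinuousOn (fun r : ℝ × E => maximalFlow U V r.1 r.2) (Ioo (-ε) ε ×ˢ W) := by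
  obtain ⟨ε₀, hε₀, a, r, L, K, hr, hpl⟩ := IsPicardLindelof.of_contDiffAt_one (hV q hq)
  obtain ⟨α, hα, hαc⟩ :=
    (hpl 0).exists_forall_mem_closedBall_eq_hasDerivWithinAt_continuousOn
  simp only [zero_sub, zero_add] at hα hαc
  have hαc' : ContinuousOn α (Metric.ball q r ×ˢ Ioo (-ε₀) ε₀) :=
    hαc.mono (prod_mono Metric.ball_subset_closedBall Ioo_subset_Icc_self)
  have hmem : α ⁻¹' U ∈ 𝓝 (q, (0 : ℝ)) := by
    refine (hαc'.continuousAt ?_).preimage_mem_nhds ?_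
    · exact prod_mem_nhds (Metric.ball_mem_nhds q hr) (Ioo_mem_nhds (by linarith) hε₀)
    · rw [(hα q (Metric.mem_closedBall_self hr.le)).1]
      exact hUo.mem_nhds hq
  obtain ⟨W', hW', T, hT, hWT⟩ := mem_nhds_prod_iff.1 hmem
  obtain ⟨ε₁, hε₁, hT'⟩ := Metric.mem_nhds_iff.1 hT
  obtain ⟨W, hWW', hWo, hqW⟩ := mem_nhds_iff.1 hW'
  rw [Real.ball_eq_Ioo, zero_sub, zero_add] at hT'
  set ε := min ε₀ ε₁
  have sub₀ : Ioo (-ε) ε ⊆ Ioo (-ε₀) ε₀ :=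
    Ioo_subset_Ioo (neg_le_neg (min_le_left _ _)) (min_le_left _ _)
  have sub₁ : Ioo (-ε) ε ⊆ Ioo (-ε₁) ε₁ :=
    Ioo_subset_Ioo (neg_le_neg (min_le_right _ _)) (min_le_right _ _)
  have hε : 0 < ε := lt_min hε₀ hε₁
  have main : ∀ x ∈ W ∩ Metric.ball q r, ∀ t ∈ Ioo (-ε) ε,
      (t, x) ∈ maximalFlowDomain U V ∧ maximalFlow U V t x = α (x, t) := by
    intro x hx t ht
    obtain ⟨hx0, hxd⟩ := hα x (Metric.ball_subset_closedBall hx.2)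
    have := maximalFlow_eq hV (J := Ioo (-ε) ε) (γ := fun s => α (x, s)) isOpen_Ioo
      ordConnected_Ioo ⟨by linarith, hε⟩
      (fun s hs => (hxd s (Ioo_subset_Icc_self (sub₀ hs))).mono
        (sub₀.trans Ioo_subset_Icc_self))
      (fun s hs => hWT ⟨hWW' hx.1, hT' (sub₁ hs)⟩) ht
    simpa only [hx0] using this
  refine ⟨ε, hε, W ∩ Metric.ball q r, hWo.inter Metric.isOpen_ball,
    ⟨hqW, Metric.mem_ball_self hr⟩, fun z hz => (main _ hz.2 _ hz.1).1, ?_⟩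
  refine ContinuousOn.congr (f := fun z : ℝ × E => α (z.2, z.1)) ?_
    (fun z hz => (main _ hz.2 _ hz.1).2)
  exact hαc'.comp (by fun_prop) (fun z hz => ⟨hz.2.2, sub₀ hz.1⟩)

/-- Near each time of a trajectory, the property "the flow is defined and continuous around this
point of space-time" passes from any time to any other, because the two differ by the local flow. -/
theorem continuousAt_maximalFlow_propagates (hUo : IsOpen U)
    (hV : ∀ p ∈ U, ContDiffAt ℝ 1 V p) {t : ℝ} {p : E} (h : (t, p) ∈ maximalFlowDomain U V) :
    ∃ N ∈ 𝓝 t, ∀ s ∈ N, ∀ s' ∈ N,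
      (maximalFlowDomain U V ∈ 𝓝 (s, p) ∧
        ContinuousAt (fun r : ℝ × E => maximalFlow U V r.1 r.2) (s, p)) →
      maximalFlowDomain U V ∈ 𝓝 (s', p) ∧
        ContinuousAt (fun r : ℝ × E => maximalFlow U V r.1 r.2) (s', p) := by
  obtain ⟨ε, hε, W, hWo, hW, hsub, hcont⟩ :=
    exists_box_subset_maximalFlowDomain hUo hV (maximalFlow_mem hV h)
  refine ⟨Ioo (t - ε / 2) (t + ε / 2) ∩ (fun s => maximalFlow U V s p) ⁻¹' W,
    inter_mem (Ioo_mem_nhds (by linarith) (by linarith))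
      ((hasDerivAt_maximalFlow hV h).continuousAt.preimage_mem_nhds (hWo.mem_nhds hW)), ?_⟩
  rintro s ⟨hs, hsW⟩ s' ⟨hs', -⟩ ⟨hD, hc⟩
  -- the section of the flow at the fixed time `s`
  have hι : Tendsto (fun z : ℝ × E => (s, z.2)) (𝓝 (s', p)) (𝓝 (s, p)) :=
    Continuous.tendsto' (by fun_prop) _ _ rfl
  have hcs : Tendsto (fun z : ℝ × E => maximalFlow U V s z.2) (𝓝 (s', p))
      (𝓝 (maximalFlow U V s p)) := hc.tendsto.comp hι
  have hbox : Ioo (-ε) ε ×ˢ W ∈ 𝓝 (s' - s, maximalFlow U V s p) :=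
    (isOpen_Ioo.prod hWo).mem_nhds ⟨⟨by linarith [hs.2, hs'.1], by linarith [hs.1, hs'.2]⟩, hsW⟩
  have hpair : Tendsto (fun z : ℝ × E => (z.1 - s, maximalFlow U V s z.2)) (𝓝 (s', p))
      (𝓝 (s' - s, maximalFlow U V s p)) :=
    (Continuous.tendsto' (by fun_prop) _ _ rfl : Tendsto (fun z : ℝ × E => z.1 - s)
      (𝓝 (s', p)) (𝓝 (s' - s))).prodMk_nhds hcs
  have hev : ∀ᶠ z : ℝ × E in 𝓝 (s', p), z ∈ maximalFlowDomain U V ∧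
      maximalFlow U V (z.1 - s) (maximalFlow U V s z.2) = maximalFlow U V z.1 z.2 := by
    filter_upwards [hι hD, hpair hbox] with z hz hz'
    have hz1 := add_mem_maximalFlowDomain hV hz (hsub hz')
    have := (maximalFlow_sub hV hz hz1).2
    simp only [add_sub_cancel] at hz1 this
    exact ⟨hz1, this⟩
  refine ⟨hev.mono fun z hz => hz.1, ?_⟩
  have hlim := (hcont.continuousAt hbox).tendsto.comp hpair
  have hval := hev.self_of_nhds.2
  simp only at hval
  rw [hval] at hlim
  exact hlim.congr' (hev.mono fun z hz => hz.2)

/-- The domain of the flow is open, and the flow is jointly continuous on it. -/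
theorem continuousAt_maximalFlow (hUo : IsOpen U) (hV : ∀ p ∈ U, ContDiffAt ℝ 1 V p)
    {t : ℝ} {p : E} (h : (t, p) ∈ maximalFlowDomain U V) :
    maximalFlowDomain U V ∈ 𝓝 (t, p) ∧
      ContinuousAt (fun r : ℝ × E => maximalFlow U V r.1 r.2) (t, p) := by
  set G : Set ℝ := {s | maximalFlowDomain U V ∈ 𝓝 (s, p) ∧
      ContinuousAt (fun r : ℝ × E => maximalFlow U V r.1 r.2) (s, p)} with hG
  have hGo : IsOpen G := by
    rw [isOpen_iff_mem_nhds]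
    intro s hs
    obtain ⟨N, hN, hprop⟩ := continuousAt_maximalFlow_propagates hUo hV (mem_of_mem_nhds hs.1)
    filter_upwards [hN] with s' hs' using hprop s (mem_of_mem_nhds hN) s' hs' hs
  have h0 : (0 : ℝ) ∈ G := by
    obtain ⟨ε, hε, W, hWo, hW, hsub, hcont⟩ :=
      exists_box_subset_maximalFlowDomain hUo hV (mem_of_mem_maximalFlowDomain h)
    have hbox : Ioo (-ε) ε ×ˢ W ∈ 𝓝 ((0 : ℝ), p) :=
      (isOpen_Ioo.prod hWo).mem_nhds ⟨⟨by linarith, hε⟩, hW⟩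
    exact ⟨mem_of_superset hbox hsub, hcont.continuousAt hbox⟩
  have hsubset : {s : ℝ | (s, p) ∈ maximalFlowDomain U V} ⊆ G := by
    refine (ordConnected_maximalFlowDomain_time U V p).isPreconnected
      |>.subset_of_closure_inter_subset hGo ⟨0, zero_mem_of_mem_maximalFlowDomain h, h0⟩ ?_
    rintro s ⟨hsc, hs⟩
    obtain ⟨N, hN, hprop⟩ := continuousAt_maximalFlow_propagates hUo hV hs
    obtain ⟨s', hs'N, hs'⟩ := mem_closure_iff_nhds.1 hsc N hN
    exact hprop s' hs'N s (mem_of_mem_nhds hN) hs'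
  exact hsubset h

theorem isFlowOfField_maximalFlow (hUo : IsOpen U) (hV : ∀ p ∈ U, ContDiffAt ℝ 1 V p) :
    IsFlowOfField U V (maximalFlowDomain U V) (maximalFlow U V) := by
  have hzero : ∀ p ∈ U, ((0 : ℝ), p) ∈ maximalFlowDomain U V := by
    intro p hp
    obtain ⟨ε, hε, W, hWo, hW, hsub, -⟩ := exists_box_subset_maximalFlowDomain hUo hV hp
    exact hsub ⟨⟨by linarith, hε⟩, hW⟩
  exact
    { isOpen_phase := hUo
      isOpen_domain := isOpen_iff_mem_nhds.2 fun _ hq => (continuousAt_maximalFlow hUo hV hq).1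
      mem_phase := fun _ _ h => mem_of_mem_maximalFlowDomain h
      zero_mem := hzero
      ordConnected := ordConnected_maximalFlowDomain_time U V
      continuousOn := fun _ hq => (continuousAt_maximalFlow hUo hV hq).2.continuousWithinAt
      map_mem := fun _ _ h => maximalFlow_mem hV h
      map_zero := fun p hp => maximalFlow_zero hV (hzero p hp)
      add_mem_iff := fun _ _ _ h =>
        ⟨fun hs => add_mem_maximalFlowDomain hV h hs, fun hs => (maximalFlow_sub hV h hs).1⟩
      map_add := fun _ _ _ h hs =>
        (maximalFlow_sub hV h (add_mem_maximalFlowDomain hV h hs)).2.symm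
      hasDerivAt := fun _ _ h => hasDerivAt_maximalFlow hV h
      maximal := fun _ _ hJ hJc h0 hγ hU _ ht => maximalFlow_eq hV hJ hJc h0 hγ hU ht }

end MaximalFlow

/-! ### The Jacobi elliptic functions -/

section Jacobi

/-- `jacobiAm` is a true inverse where `ellipticF` is injective on `ellipticDomain`; outside the
range of `ellipticF` it would be a junk value. -/
theorem jacobiAm_ellipticF {k φ : ℝ} (hinj : InjOn (ellipticF k) (ellipticDomain k))
    (hφ : φ ∈ ellipticDomain k) : jacobiAm k (ellipticF k φ) = φ :=
  hinj.leftInvOn_invFunOn hφ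

theorem one_sub_sq_mul_sin_sq_pos {k : ℝ} (hk0 : 0 ≤ k) (hk1 : k < 1) (θ : ℝ) :
    0 < 1 - k ^ 2 * Real.sin θ ^ 2 := by
  have h1 : k ^ 2 < 1 := by nlinarith
  nlinarith [Real.sin_sq_le_one θ, sq_nonneg (Real.sin θ), sq_nonneg k]

theorem continuous_ellipticIntegrand {k : ℝ} (hk0 : 0 ≤ k) (hk1 : k < 1) :
    Continuous (ellipticIntegrand k) := by
  refine Continuous.div continuous_const (by fun_prop) fun θ => ?_
  exact (Real.sqrt_pos.2 (one_sub_sq_mul_sin_sq_pos hk0 hk1 θ)).ne'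

theorem ellipticDomain_eq_univ {k : ℝ} (hk0 : 0 ≤ k) (hk1 : k < 1) :
    ellipticDomain k = univ :=
  eq_univ_of_forall fun _ => (continuous_ellipticIntegrand hk0 hk1).intervalIntegrable _ _

theorem hasDerivAt_ellipticF {k : ℝ} (hk0 : 0 ≤ k) (hk1 : k < 1) (φ : ℝ) :
    HasDerivAt (ellipticF k) (ellipticIntegrand k φ) φ :=
  (continuous_ellipticIntegrand hk0 hk1).integral_hasStrictDerivAt 0 φ |>.hasDerivAt

theorem one_le_ellipticIntegrand {k : ℝ} (hk0 : 0 ≤ k) (hk1 : k < 1) (θ : ℝ) :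
    1 ≤ ellipticIntegrand k θ := by
  rw [ellipticIntegrand, le_div_iff₀ (Real.sqrt_pos.2 (one_sub_sq_mul_sin_sq_pos hk0 hk1 θ)),
    one_mul]
  exact Real.sqrt_le_one.2 (by nlinarith [mul_nonneg (sq_nonneg k) (sq_nonneg (Real.sin θ))])

/-- For `k < 1` the function `F(·, k)` increases at least as fast as the identity. -/
theorem sub_le_ellipticF_sub {k : ℝ} (hk0 : 0 ≤ k) (hk1 : k < 1) {a b : ℝ} (hab : a ≤ b) :
    b - a ≤ ellipticF k b - ellipticF k a := by
  have hd : ∀ x, HasDerivAt (fun x => ellipticF k x - x) (ellipticIntegrand k x - 1) x :=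
    fun x => (hasDerivAt_ellipticF hk0 hk1 x).sub (hasDerivAt_id x)
  have hmono : Monotone fun x => ellipticF k x - x :=
    monotone_of_deriv_nonneg (fun x => (hd x).differentiableAt) fun x => by
      rw [(hd x).deriv]
      linarith [one_le_ellipticIntegrand hk0 hk1 x]
  linarith [hmono hab]

theorem ellipticF_zero (k : ℝ) : ellipticF k 0 = 0 := intervalIntegral.integral_same

theorem strictMono_ellipticF {k : ℝ} (hk0 : 0 ≤ k) (hk1 : k < 1) : StrictMono (ellipticF k) :=
  fun _ _ hab => by linarith [sub_le_ellipticF_sub hk0 hk1 hab.le]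

theorem surjective_ellipticF {k : ℝ} (hk0 : 0 ≤ k) (hk1 : k < 1) :
    Function.Surjective (ellipticF k) := by
  have hc : Continuous (ellipticF k) :=
    continuous_iff_continuousAt.2 fun x => (hasDerivAt_ellipticF hk0 hk1 x).continuousAt
  refine hc.surjective ?_ ?_
  · refine tendsto_atTop_mono' atTop ?_ tendsto_id
    filter_upwards [eventually_ge_atTop 0] with x hx
    simpa [ellipticF_zero] using sub_le_ellipticF_sub hk0 hk1 hx
  · refine tendsto_atBot_mono' atBot ?_ tendsto_id
    filter_upwards [eventually_le_atBot 0] with x hx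
    simpa [ellipticF_zero] using sub_le_ellipticF_sub hk0 hk1 hx

theorem hasDerivAt_jacobiAm_of_lt_one {k : ℝ} (hk0 : 0 ≤ k) (hk1 : k < 1) (u : ℝ) :
    HasDerivAt (jacobiAm k) (jacobiDn k u) u := by
  set e := (strictMono_ellipticF hk0 hk1).orderIsoOfSurjective _ (surjective_ellipticF hk0 hk1)
   
  have hright : ∀ v, ellipticF k (e.symm v) = v := fun v => e.apply_symm_apply v
  have ham : jacobiAm k = e.symm := by
    funext v
    have := jacobiAm_ellipticF (strictMono_ellipticF hk0 hk1).injective.injOn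
      (φ := e.symm v) (by rw [ellipticDomain_eq_univ hk0 hk1]; trivial)
    rwa [hright] at this
  have hd := hasDerivAt_ellipticF hk0 hk1 (jacobiAm k u)
  have hpos : 0 < ellipticIntegrand k (jacobiAm k u) :=
    one_pos.trans_le (one_le_ellipticIntegrand hk0 hk1 _)
  have := HasDerivAt.of_local_left_inverse (f := ellipticF k) (g := jacobiAm k)
    (by rw [ham]; exact e.symm.continuous.continuousAt) hd hpos.ne'
    (Eventually.of_forall fun v => by rw [ham]; exact hright v)
  simpa [ellipticIntegrand, jacobiDn, jacobiSn] using this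

theorem ellipticIntegrand_one (θ : ℝ) : ellipticIntegrand 1 θ = |Real.cos θ|⁻¹ := by
  rw [ellipticIntegrand, one_pow, one_mul, ← Real.cos_sq', Real.sqrt_sq_eq_abs, one_div]

theorem continuousOn_ellipticIntegrand_one :
    ContinuousOn (ellipticIntegrand 1) (Ioo (-(Real.pi / 2)) (Real.pi / 2)) := by
  simp only [funext ellipticIntegrand_one]
  exact ContinuousOn.inv₀ (by fun_prop) fun x hx => abs_ne_zero.2 (Real.cos_pos_of_mem_Ioo hx).ne'

/-- `1 / |cos θ|` has a non-integrable singularity at the zeros of the cosine. -/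
theorem not_intervalIntegrable_ellipticIntegrand_one {c φ : ℝ} (hc : Real.cos c = 0)
    (hcφ : c ∈ uIcc 0 φ) :
    ¬ IntervalIntegrable (ellipticIntegrand 1) MeasureTheory.volume 0 φ := by
  refine not_intervalIntegrable_of_sub_inv_isBigO_punctured (c := c) ?_ ?_ hcφ
  · refine Asymptotics.IsBigO.of_bound 1 ?_
    have hne : ∀ᶠ x in 𝓝[≠] c, Real.cos x ≠ 0 := by
      have hs : Real.sin c ≠ 0 := by
        intro hs
        have := Real.sin_sq_add_cos_sq c
        rw [hs, hc] at this
        norm_num at this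
      exact (Real.hasDerivAt_cos c).eventually_ne (neg_ne_zero.2 hs)
    filter_upwards [hne] with x hx
    rw [ellipticIntegrand_one, one_mul, norm_inv, norm_inv, Real.norm_eq_abs, Real.norm_eq_abs,
      abs_abs]
    refine inv_anti₀ (abs_pos.2 hx) ?_
    have := Real.abs_cos_sub_cos_le x c
    rwa [hc, sub_zero] at this
  · rintro rfl
    simp only [uIcc_self, mem_singleton_iff] at hcφ
    rw [hcφ, Real.cos_zero] at hc
    exact one_ne_zero hc

theorem ellipticDomain_one : ellipticDomain 1 = Ioo (-(Real.pi / 2)) (Real.pi / 2) := by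
  ext φ
  constructor
  · intro h
    by_contra hφ
    rw [mem_Ioo, not_and_or, not_lt, not_lt] at hφ
    rcases hφ with hφ | hφ
    · refine not_intervalIntegrable_ellipticIntegrand_one (c := -(Real.pi / 2)) (by simp) ?_ h
      exact mem_uIcc.2 (Or.inr ⟨hφ, by linarith [Real.pi_pos]⟩)
    · refine not_intervalIntegrable_ellipticIntegrand_one (c := Real.pi / 2) (by simp) ?_ h
      exact mem_uIcc.2 (Or.inl ⟨by linarith [Real.pi_pos], hφ⟩)
  · intro hφ
    refine (continuousOn_ellipticIntegrand_one.mono ?_).intervalIntegrable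
    exact ordConnected_Ioo.uIcc_subset ⟨by linarith [Real.pi_pos], by linarith [Real.pi_pos]⟩ hφ

theorem hasDerivAt_ellipticF_one {φ : ℝ} (hφ : φ ∈ Ioo (-(Real.pi / 2)) (Real.pi / 2)) :
    HasDerivAt (ellipticF 1) (ellipticIntegrand 1 φ) φ := by
  have hnhds := isOpen_Ioo.mem_nhds hφ
  refine intervalIntegral.integral_hasDerivAt_right ?_ ?_
    (continuousOn_ellipticIntegrand_one.continuousAt hnhds)
  · rw [← ellipticDomain_one] at hφ
    exact hφ
  · exact continuousOn_ellipticIntegrand_one.stronglyMeasurableAtFilter isOpen_Ioo _ hφ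

theorem strictMonoOn_ellipticF_one : StrictMonoOn (ellipticF 1) (ellipticDomain 1) := by
  rw [ellipticDomain_one]
  refine strictMonoOn_of_deriv_pos (convex_Ioo _ _)
    (fun x hx => (hasDerivAt_ellipticF_one hx).continuousAt.continuousWithinAt) fun x hx => ?_
  rw [interior_Ioo] at hx
  rw [(hasDerivAt_ellipticF_one hx).deriv, ellipticIntegrand_one]
  exact inv_pos.2 (abs_pos.2 (Real.cos_pos_of_mem_Ioo hx).ne')

theorem cos_arctan_sinh (u : ℝ) : Real.cos (Real.arctan (Real.sinh u)) = (Real.cosh u)⁻¹ := by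
  rw [Real.cos_arctan, ← Real.cosh_sq', Real.sqrt_sq (Real.cosh_pos u).le, one_div]

theorem hasDerivAt_arctan_sinh (u : ℝ) :
    HasDerivAt (fun u => Real.arctan (Real.sinh u)) (Real.cosh u)⁻¹ u := by
  have h := (Real.hasDerivAt_sinh u).arctan
  rw [← Real.cosh_sq'] at h
  convert h using 1
  field_simp [(Real.cosh_pos u).ne']

/-- At `k = 1` the amplitude is the Gudermannian function. -/
theorem jacobiAm_one (u : ℝ) : jacobiAm 1 u = Real.arctan (Real.sinh u) := by
  have hmem : ∀ v, Real.arctan (Real.sinh v) ∈ Ioo (-(Real.pi / 2)) (Real.pi / 2) :=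
    fun v => Real.arctan_mem_Ioo _
  have hd : ∀ v, HasDerivAt (fun v => ellipticF 1 (Real.arctan (Real.sinh v)) - v) 0 v := by
    intro v
    refine (((hasDerivAt_ellipticF_one (hmem v)).comp v (hasDerivAt_arctan_sinh v)).sub
      (hasDerivAt_id v)).congr_deriv ?_
    rw [ellipticIntegrand_one, cos_arctan_sinh, abs_of_pos (inv_pos.2 (Real.cosh_pos v)), inv_inv,
      mul_inv_cancel₀ (Real.cosh_pos v).ne', sub_self]
  have hF : ellipticF 1 (Real.arctan (Real.sinh u)) = u := by
    have := is_const_of_deriv_eq_zero (fun v => (hd v).differentiableAt) (fun v => (hd v).deriv) u 0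
    simpa [ellipticF_zero, sub_eq_zero] using this
  have := jacobiAm_ellipticF strictMonoOn_ellipticF_one.injOn (ellipticDomain_one ▸ hmem u)
  rwa [hF] at this

variable {k : ℝ}

theorem hasDerivAt_jacobiAm (hk0 : 0 ≤ k) (hk1 : k ≤ 1) (u : ℝ) :
    HasDerivAt (jacobiAm k) (jacobiDn k u) u := by
  rcases hk1.lt_or_eq with hk1 | rfl
  · exact hasDerivAt_jacobiAm_of_lt_one hk0 hk1 u
  · rw [jacobiDn, jacobiSn, one_pow, one_mul, ← Real.cos_sq', Real.sqrt_sq_eq_abs,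
      jacobiAm_one, cos_arctan_sinh, abs_of_pos (inv_pos.2 (Real.cosh_pos u))]
    simpa only [funext jacobiAm_one] using hasDerivAt_arctan_sinh u

theorem jacobiAm_zero (hk0 : 0 ≤ k) (hk1 : k ≤ 1) : jacobiAm k 0 = 0 := by
  rcases hk1.lt_or_eq with hk1 | rfl
  · have := jacobiAm_ellipticF (strictMono_ellipticF hk0 hk1).injective.injOn
      (φ := 0) (by rw [ellipticDomain_eq_univ hk0 hk1]; trivial)
    rwa [ellipticF_zero] at this
  · simp [jacobiAm_one]

theorem jacobiSn_zero (hk0 : 0 ≤ k) (hk1 : k ≤ 1) : jacobiSn k 0 = 0 := by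
  rw [jacobiSn, jacobiAm_zero hk0 hk1, Real.sin_zero]

theorem jacobiCn_zero (hk0 : 0 ≤ k) (hk1 : k ≤ 1) : jacobiCn k 0 = 1 := by
  rw [jacobiCn, jacobiAm_zero hk0 hk1, Real.cos_zero]

theorem jacobiDn_zero (hk0 : 0 ≤ k) (hk1 : k ≤ 1) : jacobiDn k 0 = 1 := by
  simp [jacobiDn, jacobiSn_zero hk0 hk1]

theorem jacobiSn_sq_add_jacobiCn_sq (k u : ℝ) : jacobiSn k u ^ 2 + jacobiCn k u ^ 2 = 1 :=
  Real.sin_sq_add_cos_sq _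

theorem one_sub_sq_mul_jacobiSn_sq_pos (hk0 : 0 ≤ k) (hk1 : k ≤ 1) (u : ℝ) :
    0 < 1 - k ^ 2 * jacobiSn k u ^ 2 := by
  rcases hk1.lt_or_eq with hk1 | rfl
  · exact one_sub_sq_mul_sin_sq_pos hk0 hk1 _
  · rw [jacobiSn, one_pow, one_mul, ← Real.cos_sq', jacobiAm_one, cos_arctan_sinh]
    exact pow_pos (inv_pos.2 (Real.cosh_pos u)) 2

theorem jacobiDn_pos (hk0 : 0 ≤ k) (hk1 : k ≤ 1) (u : ℝ) : 0 < jacobiDn k u :=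
  Real.sqrt_pos.2 (one_sub_sq_mul_jacobiSn_sq_pos hk0 hk1 u)

theorem jacobiDn_sq (hk0 : 0 ≤ k) (hk1 : k ≤ 1) (u : ℝ) :
    jacobiDn k u ^ 2 = 1 - k ^ 2 * jacobiSn k u ^ 2 :=
  Real.sq_sqrt (one_sub_sq_mul_jacobiSn_sq_pos hk0 hk1 u).le

theorem hasDerivAt_jacobiSn (hk0 : 0 ≤ k) (hk1 : k ≤ 1) (u : ℝ) :
    HasDerivAt (jacobiSn k) (jacobiCn k u * jacobiDn k u) u :=
  (hasDerivAt_jacobiAm hk0 hk1 u).sin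

theorem hasDerivAt_jacobiCn (hk0 : 0 ≤ k) (hk1 : k ≤ 1) (u : ℝ) :
    HasDerivAt (jacobiCn k) (-jacobiSn k u * jacobiDn k u) u :=
  (hasDerivAt_jacobiAm hk0 hk1 u).cos

theorem hasDerivAt_jacobiDn (hk0 : 0 ≤ k) (hk1 : k ≤ 1) (u : ℝ) :
    HasDerivAt (jacobiDn k) (-k ^ 2 * jacobiSn k u * jacobiCn k u) u := by
  have h := ((((hasDerivAt_jacobiSn hk0 hk1 u).pow 2).const_mul (k ^ 2)).const_sub 1).sqrt
    (one_sub_sq_mul_jacobiSn_sq_pos hk0 hk1 u).ne'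
  refine h.congr_deriv ?_
  have hd : √(1 - k ^ 2 * jacobiSn k u ^ 2) = jacobiDn k u := rfl
  have hpos := jacobiDn_pos hk0 hk1 u
  simp only [Pi.pow_apply, hd]
  field_simp
  norm_num
  ring

end Jacobi

/-! ### The explicit solution of the tetrahedral system -/

section ExplicitSolution

/-- For any functions with the derivatives of `sn`, `cn`, `dn` at `l t`, and with the algebraic
relations between them, the three quotients of the explicit solution satisfy `A' = BC`,
`B' = AC`, `C' = AB`. After division by `l` all parameters are expressed through `a / l`, `b / l`
and `r`, and the claims are identities modulo the relations. -/
theorem hasDerivAt_quotients_of_jacobi_relations {S C D : ℝ → ℝ} {l k r a b c t : ℝ} (hl : l ≠ 0)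
    (hS : HasDerivAt S (l * (C t * D t)) t) (hC : HasDerivAt C (l * (-S t * D t)) t)
    (hD : HasDerivAt D (l * (-k ^ 2 * S t * C t)) t)
    (hSC : S t ^ 2 + C t ^ 2 = 1) (hSD : D t ^ 2 = 1 - k ^ 2 * S t ^ 2)
    (hl2 : l ^ 2 = a ^ 2 - c ^ 2) (hk : k ^ 2 * l ^ 2 = a ^ 2 - b ^ 2) (hr : r * b = c)
    (hE : C t - r * a / l * (S t * D t) ≠ 0) :
    HasDerivAt (fun s => (a * D s - l * k ^ 2 * r * (S s * C s)) / (C s - r * a / l * (S s * D s)))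
      ((b * (1 - k ^ 2 * r ^ 2 * S t ^ 2) / (C t - r * a / l * (S t * D t))) *
        ((c * (C t * D t) + a / l * (b - r * c) * S t) / (C t - r * a / l * (S t * D t)))) t ∧
    HasDerivAt (fun s => b * (1 - k ^ 2 * r ^ 2 * S s ^ 2) / (C s - r * a / l * (S s * D s)))
      (((a * D t - l * k ^ 2 * r * (S t * C t)) / (C t - r * a / l * (S t * D t))) *
        ((c * (C t * D t) + a / l * (b - r * c) * S t) / (C t - r * a / l * (S t * D t)))) t ∧
    HasDerivAt (fun s => (c * (C s * D s) + a / l * (b - r * c) * S s) /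
        (C s - r * a / l * (S s * D s)))
      (((a * D t - l * k ^ 2 * r * (S t * C t)) / (C t - r * a / l * (S t * D t))) *
        (b * (1 - k ^ 2 * r ^ 2 * S t ^ 2) / (C t - r * a / l * (S t * D t)))) t := by
  obtain ⟨α, rfl⟩ : ∃ α, a = l * α := ⟨a / l, by field_simp⟩
  obtain ⟨β, rfl⟩ : ∃ β, b = l * β := ⟨b / l, by field_simp⟩
  subst hr
  have hα : α ^ 2 - r ^ 2 * β ^ 2 = 1 :=
    mul_left_cancel₀ (pow_ne_zero 2 hl) (by linear_combination -hl2)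
  have hk' : k ^ 2 = α ^ 2 - β ^ 2 :=
    mul_left_cancel₀ (pow_ne_zero 2 hl) (by linear_combination hk)
  have e₁ : r * (l * α) / l = r * α := by field_simp
  have e₂ : l * α / l = α := by field_simp
  simp only [e₁, e₂] at hE ⊢
  have hden : HasDerivAt (fun s => C s - r * α * (S s * D s)) _ t :=
    hC.sub ((hS.mul hD).const_mul (r * α))
  have hquot : ∀ {N : ℝ → ℝ} {N' m₁ m₂ : ℝ}, HasDerivAt N N' t →
      N' * (C t - r * α * (S t * D t)) - N t * (l * (-S t * D t) -
        r * α * (l * (C t * D t) * D t + S t * (l * (-k ^ 2 * S t * C t)))) = m₁ * m₂ →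
      HasDerivAt (fun s => N s / (C s - r * α * (S s * D s)))
        (m₁ / (C t - r * α * (S t * D t)) * (m₂ / (C t - r * α * (S t * D t)))) t := by
    intro N N' m₁ m₂ hN h
    refine (hN.fun_div hden hE).congr_deriv ?_
    rw [h]
    field_simp
  refine ⟨hquot (((hD.const_mul (l * α)).sub ((hS.mul hC).const_mul (l * k ^ 2 * r)))) ?_,
    hquot ((((hS.pow 2).const_mul (k ^ 2 * r ^ 2)).const_sub 1).const_mul (l * β)) ?_,
    hquot (((hC.mul hD).const_mul (r * (l * β))).add
      (hS.const_mul (α * (l * β - r * (r * (l * β)))))) ?_⟩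
  all_goals
    clear hS hC hD hden hquot hl2 hk e₁ e₂ hE
    generalize S t = s at *
    generalize C t = c at *
    generalize D t = d at *
  · have h : (α * (-k ^ 2 * s * c) - k ^ 2 * r * (c * d * c + s * (-s * d))) *
          (c - r * α * (s * d)) - (α * d - k ^ 2 * r * (s * c)) *
          (-s * d - r * α * (c * d * d + s * (-k ^ 2 * s * c))) =
        β * (1 - k ^ 2 * r ^ 2 * s ^ 2) * (r * β * (c * d) + α * (β - r * (r * β)) * s) := by
      grind
    linear_combination l ^ 2 * h
  · have h : β * (-k ^ 2 * r ^ 2 * (2 * s * (c * d))) * (c - r * α * (s * d)) -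
          β * (1 - k ^ 2 * r ^ 2 * s ^ 2) *
          (-s * d - r * α * (c * d * d + s * (-k ^ 2 * s * c))) =
        (α * d - k ^ 2 * r * (s * c)) * (r * β * (c * d) + α * (β - r * (r * β)) * s) := by
      grind
    linear_combination l ^ 2 * h
  · have h : (r * β * (-s * d * d + c * (-k ^ 2 * s * c)) + α * (β - r * (r * β)) * (c * d)) *
          (c - r * α * (s * d)) - (r * β * (c * d) + α * (β - r * (r * β)) * s) *
          (-s * d - r * α * (c * d * d + s * (-k ^ 2 * s * c))) =
        (α * d - k ^ 2 * r * (s * c)) * (β * (1 - k ^ 2 * r ^ 2 * s ^ 2)) := by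
      grind
    linear_combination l ^ 2 * h

variable {a b c : ℝ}

theorem solLam_pos (hca : c ^ 2 < a ^ 2) : 0 < solLam a c := Real.sqrt_pos.2 (sub_pos.2 hca)

theorem solLam_sq (hca : c ^ 2 < a ^ 2) : solLam a c ^ 2 = a ^ 2 - c ^ 2 :=
  Real.sq_sqrt (sub_pos.2 hca).le

theorem solMod_nonneg (a b c : ℝ) : 0 ≤ solMod a b c := Real.sqrt_nonneg _

theorem solMod_le_one (hcb : c ^ 2 ≤ b ^ 2) (hca : c ^ 2 < a ^ 2) : solMod a b c ≤ 1 := by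
  refine Real.sqrt_le_one.2 ?_
  rw [div_le_one (sub_pos.2 hca)]
  linarith

theorem solMod_sq (hba : b ^ 2 ≤ a ^ 2) (hca : c ^ 2 < a ^ 2) :
    solMod a b c ^ 2 = (a ^ 2 - b ^ 2) / (a ^ 2 - c ^ 2) :=
  Real.sq_sqrt (div_nonneg (sub_nonneg.2 hba) (sub_pos.2 hca).le)

/-- The ratio `c / b` works for `b = 0` as well, since then `c = 0`. -/
theorem div_mul_cancel_of_sq_le_sq (hcb : c ^ 2 ≤ b ^ 2) : c / b * b = c := by
  rcases eq_or_ne b 0 with rfl | hb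
  · have : c = 0 := by nlinarith
    simp [this]
  · exact div_mul_cancel₀ c hb

theorem solDen_zero (hcb : c ^ 2 ≤ b ^ 2) (hca : c ^ 2 < a ^ 2) : solDen a b c 0 = 1 := by
  have hk0 := solMod_nonneg a b c
  have hk1 := solMod_le_one hcb hca
  simp [solDen, jacobiSn_zero hk0 hk1, jacobiCn_zero hk0 hk1]

theorem sol_zero (hcb : c ^ 2 ≤ b ^ 2) (hca : c ^ 2 < a ^ 2) :
    solMax a b c 0 = a ∧ solMid a b c 0 = b ∧ solMin a b c 0 = c := by
  have hk0 := solMod_nonneg a b c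
  have hk1 := solMod_le_one hcb hca
  simp [solMax, solMid, solMin, solDen_zero hcb hca, jacobiSn_zero hk0 hk1,
    jacobiCn_zero hk0 hk1, jacobiDn_zero hk0 hk1]

theorem HasDerivAt.comp_const_mul_left {f : ℝ → ℝ} {f' : ℝ} {l t : ℝ}
    (hf : HasDerivAt f f' (l * t)) : HasDerivAt (fun s => f (l * s)) (l * f') t := by
  have h := hf.comp t ((hasDerivAt_id t).const_mul l)
  rw [mul_one, mul_comm] at h
  exact h

/-- The explicit functions solve `A' = BC`, `B' = AC`, `C' = AB` off the zeros of the
denominator. -/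
theorem hasDerivAt_sol (hcb : c ^ 2 ≤ b ^ 2) (hba : b ^ 2 ≤ a ^ 2) (hca : c ^ 2 < a ^ 2) {t : ℝ}
    (ht : solDen a b c t ≠ 0) :
    HasDerivAt (solMax a b c) (solMid a b c t * solMin a b c t) t ∧
    HasDerivAt (solMid a b c) (solMax a b c t * solMin a b c t) t ∧
    HasDerivAt (solMin a b c) (solMax a b c t * solMid a b c t) t := by
  have hk0 := solMod_nonneg a b c
  have hk1 := solMod_le_one hcb hca
  refine hasDerivAt_quotients_of_jacobi_relations (solLam_pos hca).ne'
    (hasDerivAt_jacobiSn hk0 hk1 _).comp_const_mul_left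
    (hasDerivAt_jacobiCn hk0 hk1 _).comp_const_mul_left
    (hasDerivAt_jacobiDn hk0 hk1 _).comp_const_mul_left
    (jacobiSn_sq_add_jacobiCn_sq _ _) (jacobiDn_sq hk0 hk1 _) (solLam_sq hca) ?_
    (div_mul_cancel_of_sq_le_sq hcb) ht
  rw [solMod_sq hba hca, solLam_sq hca, div_mul_cancel₀ _ (sub_pos.2 hca).ne']

theorem continuous_jacobiSn {k : ℝ} (hk0 : 0 ≤ k) (hk1 : k ≤ 1) : Continuous (jacobiSn k) :=
  continuous_iff_continuousAt.2 fun u => (hasDerivAt_jacobiSn hk0 hk1 u).continuousAt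

theorem continuous_jacobiCn {k : ℝ} (hk0 : 0 ≤ k) (hk1 : k ≤ 1) : Continuous (jacobiCn k) :=
  continuous_iff_continuousAt.2 fun u => (hasDerivAt_jacobiCn hk0 hk1 u).continuousAt

theorem continuous_jacobiDn {k : ℝ} (hk0 : 0 ≤ k) (hk1 : k ≤ 1) : Continuous (jacobiDn k) :=
  continuous_iff_continuousAt.2 fun u => (hasDerivAt_jacobiDn hk0 hk1 u).continuousAt

theorem continuous_solDen (hcb : c ^ 2 ≤ b ^ 2) (hca : c ^ 2 < a ^ 2) :
    Continuous (solDen a b c) := by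
  have hk0 := solMod_nonneg a b c
  have hk1 := solMod_le_one hcb hca
  have hs := continuous_jacobiSn hk0 hk1
  have hc := continuous_jacobiCn hk0 hk1
  have hd := continuous_jacobiDn hk0 hk1
  unfold solDen
  fun_prop

/-- The numerator of the middle function `B`. -/
noncomputable def solMidNum (a b c t : ℝ) : ℝ :=
  b * (1 - solMod a b c ^ 2 * (c / b) ^ 2 * jacobiSn (solMod a b c) (solLam a c * t) ^ 2)

theorem continuous_solMidNum (hcb : c ^ 2 ≤ b ^ 2) (hca : c ^ 2 < a ^ 2) :
    Continuous (solMidNum a b c) := by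
  have hs := continuous_jacobiSn (solMod_nonneg a b c) (solMod_le_one hcb hca)
  unfold solMidNum
  fun_prop

theorem solDen_mul_solMid {t : ℝ} (ht : solDen a b c t ≠ 0) :
    solDen a b c t * solMid a b c t = solMidNum a b c t :=
  mul_div_cancel₀ _ ht

/-- At a zero of the denominator the middle function has a pole: its numerator does not vanish
unless `b = 0`, and then the denominator is `cn(·, 1) = 1 / cosh`. -/
theorem solMidNum_ne_zero (hcb : c ^ 2 ≤ b ^ 2) (hca : c ^ 2 < a ^ 2) {t : ℝ}
    (ht : solDen a b c t = 0) : solMidNum a b c t ≠ 0 := by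
  have hk0 := solMod_nonneg a b c
  have hk1 := solMod_le_one hcb hca
  have hb : b ≠ 0 := by
    rintro rfl
    have hc : c = 0 := by nlinarith
    subst hc
    have ha : a ^ 2 ≠ 0 := by
      intro h
      rw [h] at hca
      norm_num at hca
    have hk : solMod a 0 0 = 1 := by simp [solMod, div_self ha]
    rw [solDen, hk, jacobiCn, jacobiAm_one, cos_arctan_sinh] at ht
    simp only [div_zero, zero_mul, zero_div, sub_zero] at ht
    exact (inv_pos.2 (Real.cosh_pos _)).ne' ht
  refine mul_ne_zero hb (ne_of_gt ?_)
  have hr : (c / b) ^ 2 ≤ 1 := by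
    rw [div_pow, div_le_one (by positivity)]
    exact hcb
  have h1 := one_sub_sq_mul_jacobiSn_sq_pos hk0 hk1 (solLam a c * t)
  have h2 : 0 ≤ solMod a b c ^ 2 * jacobiSn (solMod a b c) (solLam a c * t) ^ 2 := by positivity
  nlinarith

/-! ### The solution with a given initial point -/

variable {q : ℝ × ℝ × ℝ}

theorem tetraDen_zero (hq : q.2.1 ^ 2 < q.1 ^ 2) : tetraDen q 0 = 1 := by
  unfold tetraDen
  split_ifs with h₁ h₂
  · exact solDen_zero hq.le (hq.trans_le h₁)
  · exact solDen_zero h₂ hq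
  · exact solDen_zero (not_le.1 h₂).le (not_le.1 h₁)

theorem tetraSol_zero (hq : q.2.1 ^ 2 < q.1 ^ 2) : tetraSol q 0 = q := by
  unfold tetraSol
  split_ifs with h₁ h₂
  · obtain ⟨e₁, e₂, e₃⟩ := sol_zero hq.le (hq.trans_le h₁)
    rw [e₁, e₂, e₃]
  · obtain ⟨e₁, e₂, e₃⟩ := sol_zero h₂ hq
    rw [e₁, e₂, e₃]
  · obtain ⟨e₁, e₂, e₃⟩ := sol_zero (not_le.1 h₂).le (not_le.1 h₁)
    rw [e₁, e₂, e₃]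

theorem continuous_tetraDen (hq : q.2.1 ^ 2 < q.1 ^ 2) : Continuous (tetraDen q) := by
  unfold tetraDen
  split_ifs with h₁ h₂
  · exact continuous_solDen hq.le (hq.trans_le h₁)
  · exact continuous_solDen h₂ hq
  · exact continuous_solDen (not_le.1 h₂).le (not_le.1 h₁)

theorem hasDerivAt_tetraSol (hq : q.2.1 ^ 2 < q.1 ^ 2) {t : ℝ} (ht : tetraDen q t ≠ 0) :
    HasDerivAt (tetraSol q) (tetraField (tetraSol q t)) t := by
  unfold tetraDen at ht
  unfold tetraSol
  split_ifs at ht ⊢ with h₁ h₂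
  · obtain ⟨e₁, e₂, e₃⟩ := hasDerivAt_sol hq.le h₁ (hq.trans_le h₁) ht
    refine (e₂.prodMk (e₃.prodMk e₁)).congr_deriv ?_
    simp only [tetraField, mul_comm]
  · obtain ⟨e₁, e₂, e₃⟩ := hasDerivAt_sol h₂ (not_le.1 h₁).le hq ht
    refine (e₁.prodMk (e₃.prodMk e₂)).congr_deriv ?_
    simp only [tetraField, mul_comm]
  · obtain ⟨e₁, e₂, e₃⟩ := hasDerivAt_sol (not_le.1 h₂).le hq.le (not_le.1 h₁) ht
    exact e₁.prodMk (e₂.prodMk e₃)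

/-- Some coordinate of the explicit solution has a pole at every zero of the denominator. -/
theorem exists_coordinate_with_pole (hq : q.2.1 ^ 2 < q.1 ^ 2) :
    ∃ (f : ℝ × ℝ × ℝ → ℝ) (N : ℝ → ℝ), Continuous f ∧ Continuous N ∧
      (∀ t, tetraDen q t ≠ 0 → tetraDen q t * f (tetraSol q t) = N t) ∧
      ∀ t, tetraDen q t = 0 → N t ≠ 0 := by
  unfold tetraDen tetraSol
  split_ifs with h₁ h₂
  · exact ⟨fun p => p.1, solMidNum q.2.2 q.1 q.2.1, by fun_prop,
      continuous_solMidNum hq.le (hq.trans_le h₁), fun t ht => solDen_mul_solMid ht,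
      fun t ht => solMidNum_ne_zero hq.le (hq.trans_le h₁) ht⟩
  · exact ⟨fun p => p.2.2, solMidNum q.1 q.2.2 q.2.1, by fun_prop,
      continuous_solMidNum h₂ hq, fun t ht => solDen_mul_solMid ht,
      fun t ht => solMidNum_ne_zero h₂ hq ht⟩
  · exact ⟨fun p => p.2.1, solMidNum q.1 q.2.1 q.2.2, by fun_prop,
      continuous_solMidNum (not_le.1 h₂).le (not_le.1 h₁), fun t ht => solDen_mul_solMid ht,
      fun t ht => solMidNum_ne_zero (not_le.1 h₂).le (not_le.1 h₁) ht⟩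

end ExplicitSolution

/-! ### Projections of the tetrahedral flow -/

section Projection

/-- A projective flow is generated by a field that is homogeneous of degree two: the curves
`t ↦ F(t, s p)` and `t ↦ s F(s t, p)` both equal `t⁻¹ φ(t s p)` for small `t ≠ 0`. -/
theorem IsProjectiveFlowOn.field_smul {E : Type*} [NormedAddCommGroup E] [NormedSpace ℝ E]
    {U : Set E} {V : E → E} {D : Set (ℝ × E)} {F : ℝ → E → E} (hF : IsFlowOfField U V D F)
    (h : IsProjectiveFlowOn U F) {p : E} {s : ℝ} (hs : s ≠ 0) (hp : p ∈ U) (hsp : s • p ∈ U) :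
    V (s • p) = s ^ 2 • V p := by
  obtain ⟨φ, hφ⟩ := h
  have hd₁ : HasDerivAt (fun t => F t (s • p)) (V (s • p)) 0 := by
    simpa only [hF.map_zero _ hsp] using hF.hasDerivAt 0 _ (hF.zero_mem _ hsp)
  have hd₂ : HasDerivAt (fun t : ℝ => s • F (s * t) p) (s ^ 2 • V p) 0 := by
    have hd : HasDerivAt (fun t => F t p) (V p) (s * 0) := by
      rw [mul_zero]
      simpa only [hF.map_zero _ hp] using hF.hasDerivAt 0 _ (hF.zero_mem _ hp)
    have := (hd.scomp (0 : ℝ) ((hasDerivAt_id (0 : ℝ)).const_mul s)).const_smul s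
    rw [mul_one, smul_smul, ← sq] at this
    exact this
  refine hd₁.unique (hd₂.congr_of_eventuallyEq ?_)
  have hmul : Tendsto (fun t : ℝ => s * t) (𝓝[≠] 0) (𝓝[≠] 0) := by
    refine tendsto_nhdsWithin_iff.2 ⟨?_, ?_⟩
    · exact (Continuous.tendsto' (by fun_prop) _ _ (mul_zero s)).mono_left nhdsWithin_le_nhds
    · filter_upwards [self_mem_nhdsWithin] with t ht using mul_ne_zero hs ht
  have hne : ∀ᶠ t in 𝓝[≠] (0 : ℝ), F t (s • p) = s • F (s * t) p := by
    filter_upwards [hφ _ hsp, hmul.eventually (hφ p hp)] with t h₁ h₂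
    rw [h₁, h₂, smul_smul, smul_smul, mul_inv, mul_inv_cancel_left₀ hs, mul_comm s t]
  have h0 : F 0 (s • p) = s • F (s * 0) p := by
    rw [mul_zero, hF.map_zero _ hsp, hF.map_zero _ hp]
  rw [eventually_nhdsWithin_iff] at hne
  filter_upwards [hne] with t ht
  rcases eq_or_ne t 0 with rfl | ht0
  · exact h0
  · exact ht ht0

/-- `τ` conjugates the tetrahedral flow on the surface `S` to the flow of the `C¹` field `V` on
the open region `U` of the plane, with inverse `lift`. -/
structure IsTetraChart (S : Set (ℝ × ℝ × ℝ)) (τ : ℝ × ℝ × ℝ → ℝ × ℝ)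
    (lift : ℝ × ℝ → ℝ × ℝ × ℝ) (U : Set (ℝ × ℝ)) (V : ℝ × ℝ → ℝ × ℝ) : Prop where
  isOpen : IsOpen U
  contDiffAt : ∀ p ∈ U, ContDiffAt ℝ 1 V p
  /-- the surface is invariant under the tetrahedral flow -/
  invariant : ∀ (J : Set ℝ) (γ : ℝ → ℝ × ℝ × ℝ), IsOpen J → J.OrdConnected → (0 : ℝ) ∈ J →
    IsIntegralCurveOn γ (fun _ => tetraField) J → γ 0 ∈ S → ∀ t ∈ J, γ t ∈ S
  map_mem : ∀ q ∈ S, τ q ∈ U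
  lift_mem : ∀ p ∈ U, lift p ∈ S
  map_lift : ∀ p ∈ U, τ (lift p) = p
  lift_map : ∀ q ∈ S, lift (τ q) = q
  continuousOn_lift : ContinuousOn lift U
  sq_lt_sq : ∀ q ∈ S, q.2.1 ^ 2 < q.1 ^ 2
  /-- the projection maps the tetrahedral field to `V` -/
  hasDerivAt_map : ∀ (γ : ℝ → ℝ × ℝ × ℝ) (t : ℝ), HasDerivAt γ (tetraField (γ t)) t → γ t ∈ S →
    HasDerivAt (fun s => τ (γ s)) (V (τ (γ t))) t

variable {S : Set (ℝ × ℝ × ℝ)} {τ : ℝ × ℝ × ℝ → ℝ × ℝ} {lift : ℝ × ℝ → ℝ × ℝ × ℝ}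
  {U : Set (ℝ × ℝ)} {V : ℝ × ℝ → ℝ × ℝ}

theorem IsTetraChart.isTetraProjection (h : IsTetraChart S τ lift U V) :
    IsTetraProjection S τ (maximalFlowDomain U V) (maximalFlow U V) := by
  intro J γ hJ hJc h0 hγ hγ0 t ht
  have hS := h.invariant J γ hJ hJc h0 hγ hγ0
  exact maximalFlow_eq h.contDiffAt hJ hJc h0
    (fun s hs => (h.hasDerivAt_map γ s ((hγ s hs).hasDerivAt (hJ.mem_nhds hs))
      (hS s hs)).hasDerivWithinAt) (fun s hs => h.map_mem _ (hS s hs)) ht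

theorem forall_mem_uIcc_of_mem_ball {P : ℝ → Prop} {x ε r t : ℝ} (hr : r ∈ Metric.ball x ε)
    (ht : t ∈ Metric.ball x ε) (hP : ∀ s ∈ Metric.ball x ε, P s) (h : ∀ s ∈ uIcc 0 r, P s) :
    ∀ s ∈ uIcc 0 t, P s := by
  intro s hs
  rcases uIcc_subset_uIcc_union_uIcc (b := r) hs with hs | hs
  · exact h s hs
  · exact hP s ((convex_ball x ε).ordConnected.uIcc_subset hr ht hs)

theorem isOpen_setOf_forall_mem_uIcc_ne_zero {f : ℝ → ℝ} (hf : Continuous f) :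
    IsOpen {t : ℝ | ∀ s ∈ uIcc 0 t, f s ≠ 0} := by
  rw [isOpen_iff_mem_nhds]
  intro t ht
  obtain ⟨ε, hε, hball⟩ := Metric.isOpen_iff.1 (isOpen_ne_fun hf continuous_const) t
    (ht t right_mem_uIcc)
  filter_upwards [Metric.ball_mem_nhds t hε] with r hr
  exact forall_mem_uIcc_of_mem_ball (Metric.mem_ball_self hε) hr hball ht

theorem ordConnected_setOf_forall_mem_uIcc {P : ℝ → Prop} :
    {t : ℝ | ∀ s ∈ uIcc 0 t, P s}.OrdConnected := by
  refine IsPreconnected.ordConnected (isPreconnected_of_forall 0 fun t ht => ?_)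
  exact ⟨uIcc 0 t, fun r hr s hs => ht s (uIcc_subset_uIcc_left hr hs), left_mem_uIcc,
    right_mem_uIcc, isPreconnected_uIcc⟩

/-- Up to the first zero of the denominator the explicit solution is a trajectory, and the flow
cannot be continued beyond: on the closure of that interval `den · f(lift F) = N`, where the
continuous function `N` does not vanish at the zeros of `den`. -/
theorem IsTetraChart.isExplicitJacobiFlow (h : IsTetraChart S τ lift U V) :
    IsExplicitJacobiFlow U lift τ (maximalFlowDomain U V) (maximalFlow U V) := by
  have sol : ∀ p ∈ U, ∀ t, (∀ s ∈ uIcc 0 t, tetraDen (lift p) s ≠ 0) →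
      tetraSol (lift p) t ∈ S ∧ (t, p) ∈ maximalFlowDomain U V ∧
        maximalFlow U V t p = τ (tetraSol (lift p) t) := by
    intro p hp t ht
    have hq := h.sq_lt_sq _ (h.lift_mem p hp)
    set J : Set ℝ := {t | ∀ s ∈ uIcc 0 t, tetraDen (lift p) s ≠ 0}
    have hJ : IsOpen J := isOpen_setOf_forall_mem_uIcc_ne_zero (continuous_tetraDen hq)
    have hJc : J.OrdConnected := ordConnected_setOf_forall_mem_uIcc
    have h0 : (0 : ℝ) ∈ J := by
      intro s hs
      rw [uIcc_self, mem_singleton_iff] at hs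
      rw [hs, tetraDen_zero hq]
      exact one_ne_zero
    have hγ : IsIntegralCurveOn (tetraSol (lift p)) (fun _ => tetraField) J := fun s hs =>
      (hasDerivAt_tetraSol hq (hs s right_mem_uIcc)).hasDerivWithinAt
    have hγ0 : tetraSol (lift p) 0 ∈ S := by
      rw [tetraSol_zero hq]
      exact h.lift_mem p hp
    have := h.isTetraProjection J _ hJ hJc h0 hγ hγ0 t ht
    rw [tetraSol_zero hq, h.map_lift p hp] at this
    exact ⟨h.invariant J _ hJ hJc h0 hγ hγ0 t ht, this⟩
  have hdom : ∀ t p, (t, p) ∈ maximalFlowDomain U V →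
      ∀ s ∈ uIcc 0 t, tetraDen (lift p) s ≠ 0 := by
    intro t p htp
    have hp := mem_of_mem_maximalFlowDomain htp
    have hq := h.sq_lt_sq _ (h.lift_mem p hp)
    obtain ⟨f, N, hf, hN, hfN, hpole⟩ := exists_coordinate_with_pole hq
    suffices hsub : {t : ℝ | (t, p) ∈ maximalFlowDomain U V} ⊆
        {t | ∀ s ∈ uIcc 0 t, tetraDen (lift p) s ≠ 0} from hsub htp
    refine (ordConnected_maximalFlowDomain_time U V p).isPreconnected
      |>.subset_of_closure_inter_subset
        (isOpen_setOf_forall_mem_uIcc_ne_zero (continuous_tetraDen hq))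
        ⟨0, zero_mem_of_mem_maximalFlowDomain htp, ?_⟩ ?_
    · intro s hs
      rw [uIcc_self, mem_singleton_iff] at hs
      rw [hs, tetraDen_zero hq]
      exact one_ne_zero
    · rintro r ⟨hrc, hr⟩
      have hcont : ContinuousAt
          (fun s => tetraDen (lift p) s * f (lift (maximalFlow U V s p))) r := by
        refine (continuous_tetraDen hq).continuousAt.mul (hf.continuousAt.comp ?_)
        exact ContinuousAt.comp (f := fun s => maximalFlow U V s p)
          (h.continuousOn_lift.continuousAt (h.isOpen.mem_nhds (maximalFlow_mem h.contDiffAt hr)))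
          (hasDerivAt_maximalFlow h.contDiffAt hr).continuousAt
      have hfreq : ∃ᶠ s in 𝓝 r,
          tetraDen (lift p) s * f (lift (maximalFlow U V s p)) = N s := by
        refine (mem_closure_iff_frequently.1 hrc).mono fun s hs => ?_
        obtain ⟨hS, -, he⟩ := sol p hp s hs
        rw [he, h.lift_map _ hS]
        exact hfN s (hs s right_mem_uIcc)
      have heq : tetraDen (lift p) r * f (lift (maximalFlow U V r p)) = N r := by
        by_contra hne
        exact hfreq ((hcont.ne_iff_eventually_ne hN.continuousAt).1 hne)
      have hr0 : tetraDen (lift p) r ≠ 0 := by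
        intro h0
        rw [h0, zero_mul] at heq
        exact hpole r h0 heq.symm
      obtain ⟨ε, hε, hball⟩ := Metric.isOpen_iff.1
        (isOpen_ne_fun (continuous_tetraDen hq) continuous_const) r hr0
      obtain ⟨s, hsb, hs⟩ := mem_closure_iff_nhds.1 hrc _ (Metric.ball_mem_nhds r hε)
      exact forall_mem_uIcc_of_mem_ball hsb (Metric.mem_ball_self hε) hball hs
  refine ⟨?_, fun t p htp => (sol p (mem_of_mem_maximalFlowDomain htp) t (hdom t p htp)).2.2⟩
  ext ⟨t, p⟩
  exact ⟨fun htp => ⟨mem_of_mem_maximalFlowDomain htp, hdom t p htp⟩,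
    fun htp => (sol p htp.1 t htp.2).2.1⟩

end Projection

/-! ### The two planar charts -/

section Charts

theorem HasDerivAt.tetra_components {γ : ℝ → ℝ × ℝ × ℝ} {t : ℝ} {v : ℝ × ℝ × ℝ}
    (h : HasDerivAt γ v t) : HasDerivAt (fun s => (γ s).1) v.1 t ∧
      HasDerivAt (fun s => (γ s).2.1) v.2.1 t ∧ HasDerivAt (fun s => (γ s).2.2) v.2.2 t :=
  have h₂ : HasDerivAt (fun s => (γ s).2) v.2 t :=
    (ContinuousLinearMap.snd ℝ ℝ (ℝ × ℝ)).hasFDerivAt.comp_hasDerivAt t h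
  ⟨(ContinuousLinearMap.fst ℝ ℝ (ℝ × ℝ)).hasFDerivAt.comp_hasDerivAt t h,
    (ContinuousLinearMap.fst ℝ ℝ ℝ).hasFDerivAt.comp_hasDerivAt t h₂,
    (ContinuousLinearMap.snd ℝ ℝ ℝ).hasFDerivAt.comp_hasDerivAt t h₂⟩

/-- `x² - y²` is a first integral of the tetrahedral field. -/
theorem mem_fullCylinder_of_isIntegralCurveOn {J : Set ℝ} {γ : ℝ → ℝ × ℝ × ℝ} (hJ : IsOpen J)
    (hJc : J.OrdConnected) (h0 : (0 : ℝ) ∈ J)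
    (hγ : IsIntegralCurveOn γ (fun _ => tetraField) J) (hγ0 : γ 0 ∈ fullCylinder) :
    ∀ t ∈ J, γ t ∈ fullCylinder := by
  intro t ht
  have hd : ∀ s ∈ J, HasDerivAt (fun s => (γ s).1 ^ 2 - (γ s).2.1 ^ 2) 0 s := by
    intro s hs
    obtain ⟨h₁, h₂, -⟩ := ((hγ s hs).hasDerivAt (hJ.mem_nhds hs)).tetra_components
    refine ((h₁.pow 2).sub (h₂.pow 2)).congr_deriv ?_
    simp only [tetraField]
    ring
  have := hJ.is_const_of_deriv_eq_zero hJc.isPreconnected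
    (fun s hs => (hd s hs).differentiableAt.differentiableWithinAt)
    (fun s hs => (hd s hs).deriv) ht h0
  exact this.trans hγ0

theorem mem_halfCylinder_of_isIntegralCurveOn {J : Set ℝ} {γ : ℝ → ℝ × ℝ × ℝ} (hJ : IsOpen J)
    (hJc : J.OrdConnected) (h0 : (0 : ℝ) ∈ J)
    (hγ : IsIntegralCurveOn γ (fun _ => tetraField) J) (hγ0 : γ 0 ∈ halfCylinder) :
    ∀ t ∈ J, γ t ∈ halfCylinder := by
  intro t ht
  have hfull := mem_fullCylinder_of_isIntegralCurveOn hJ hJc h0 hγ hγ0.1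
  refine ⟨hfull t ht, ?_⟩
  -- the component `x` cannot change sign, since `x² = 1 + y²`
  by_contra hneg
  have hcont : ContinuousOn (fun s => (γ s).1) J := continuous_fst.comp_continuousOn hγ.continuousOn
  obtain ⟨s, hs, hs0⟩ := hJc.isPreconnected.intermediate_value ht h0 hcont
    ⟨not_lt.1 hneg, hγ0.2.le⟩
  have h1 : (γ s).1 ^ 2 - (γ s).2.1 ^ 2 = 1 := hfull s hs
  simp only at hs0
  rw [hs0] at h1
  nlinarith [sq_nonneg (γ s).2.1]

theorem isTetraChart_halfCylinder :
    IsTetraChart halfCylinder projYZ liftYZ univ fieldPiTheta where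
  isOpen := isOpen_univ
  contDiffAt p _ := by
    have hs : ContDiff ℝ 1 fun p : ℝ × ℝ => √(1 + p.1 ^ 2) :=
      ContDiff.sqrt (by fun_prop) fun p => by positivity
    unfold fieldPiTheta
    fun_prop
  invariant _ _ hJ hJc h0 hγ hγ0 := mem_halfCylinder_of_isIntegralCurveOn hJ hJc h0 hγ hγ0
  map_mem _ _ := mem_univ _
  lift_mem p _ := by
    refine ⟨?_, Real.sqrt_pos.2 (by positivity)⟩
    simp only [liftYZ]
    rw [Real.sq_sqrt (by positivity)]
    ring
  map_lift _ _ := rfl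
  lift_map q hq := by
    refine Prod.ext ?_ rfl
    simp only [liftYZ, projYZ]
    rw [show 1 + q.2.1 ^ 2 = q.1 ^ 2 by linarith [hq.1], Real.sqrt_sq hq.2.le]
  continuousOn_lift := by
    unfold liftYZ
    fun_prop
  sq_lt_sq q hq := by linarith [hq.1]
  hasDerivAt_map γ t hγ hS := by
    obtain ⟨-, h₂, h₃⟩ := hγ.tetra_components
    refine (h₂.prodMk h₃).congr_deriv ?_
    have hx : √(1 + (γ t).2.1 ^ 2) = (γ t).1 := by
      rw [show 1 + (γ t).2.1 ^ 2 = (γ t).1 ^ 2 by linarith [hS.1], Real.sqrt_sq hS.2.le]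
    simp only [fieldPiTheta, tetraField, projYZ, hx, mul_comm]

theorem add_mul_sub_eq_one {q : ℝ × ℝ × ℝ} (hq : q ∈ fullCylinder) :
    (q.1 + q.2.1) * (q.1 - q.2.1) = 1 := by
  have h : q.1 ^ 2 - q.2.1 ^ 2 = 1 := hq
  linear_combination h

theorem isTetraChart_fullCylinder :
    IsTetraChart fullCylinder projDiag liftDiag {p : ℝ × ℝ | p.1 ≠ 0} fieldPiThetaHat where
  isOpen := isOpen_ne_fun continuous_fst continuous_const
  contDiffAt p hp := by
    have hp' : p.1 ≠ 0 := hp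
    have hs : ContDiffAt ℝ 1 (fun p : ℝ × ℝ => 1 / (16 * p.1 ^ 2)) p :=
      ContDiffAt.div (by fun_prop) (by fun_prop) (by positivity)
    unfold fieldPiThetaHat
    fun_prop
  invariant _ _ hJ hJc h0 hγ hγ0 := mem_fullCylinder_of_isIntegralCurveOn hJ hJc h0 hγ hγ0
  map_mem q hq := div_ne_zero (left_ne_zero_of_mul_eq_one (add_mul_sub_eq_one hq)) two_ne_zero
  lift_mem p hp := by
    have hp' : p.1 ≠ 0 := hp
    simp only [liftDiag, fullCylinder, mem_ofPred_eq]
    field_simp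
    ring
  map_lift p _ := by
    refine Prod.ext ?_ rfl
    simp only [liftDiag, projDiag]
    ring
  lift_map q hq := by
    have h := add_mul_sub_eq_one hq
    have hne := left_ne_zero_of_mul_eq_one h
    have hinv : 1 / (4 * ((q.1 + q.2.1) / 2)) = (q.1 - q.2.1) / 2 := by
      field_simp
      linear_combination -4 * h
    refine Prod.ext ?_ (Prod.ext ?_ rfl)
    all_goals
      simp only [liftDiag, projDiag, hinv]
      ring
  continuousOn_lift := by
    have hs : ContinuousOn (fun p : ℝ × ℝ => 1 / (4 * p.1)) {p : ℝ × ℝ | p.1 ≠ 0} :=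
      ContinuousOn.div (by fun_prop) (by fun_prop) fun p hp => mul_ne_zero four_ne_zero hp
    unfold liftDiag
    fun_prop
  sq_lt_sq q hq := by
    have h : q.1 ^ 2 - q.2.1 ^ 2 = 1 := hq
    linarith
  hasDerivAt_map γ t hγ hS := by
    obtain ⟨h₁, h₂, h₃⟩ := hγ.tetra_components
    refine (((h₁.add h₂).div_const 2).prodMk h₃).congr_deriv ?_
    have h := add_mul_sub_eq_one hS
    have hne := left_ne_zero_of_mul_eq_one h
    have hinv : 1 / (16 * (((γ t).1 + (γ t).2.1) / 2) ^ 2) = (((γ t).1 - (γ t).2.1) / 2) ^ 2 := by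
      field_simp
      linear_combination
        -16 * (((γ t).1 + (γ t).2.1) * ((γ t).1 - (γ t).2.1) + 1) * h
    simp only [fieldPiThetaHat, tetraField, projDiag, hinv]
    refine Prod.ext ?_ ?_
    all_goals
      simp only
      ring

end Charts

theorem mainTheorem8 :
    (∃ (D : Set (ℝ × (ℝ × ℝ))) (F : ℝ → ℝ × ℝ → ℝ × ℝ),
      IsFlowOfField univ fieldPiTheta D F ∧
      IsTetraProjection halfCylinder projYZ D F ∧
      ¬ IsProjectiveFlowOn univ F ∧
      IsExplicitJacobiFlow univ liftYZ projYZ D F) ∧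
    (∃ (D : Set (ℝ × (ℝ × ℝ))) (F : ℝ → ℝ × ℝ → ℝ × ℝ),
      IsFlowOfField {p : ℝ × ℝ | p.1 ≠ 0} fieldPiThetaHat D F ∧
      IsTetraProjection fullCylinder projDiag D F ∧
      ¬ IsProjectiveFlowOn {p : ℝ × ℝ | p.1 ≠ 0} F ∧
      IsExplicitJacobiFlow {p : ℝ × ℝ | p.1 ≠ 0} liftDiag projDiag D F) := by
  have h₁ := isTetraChart_halfCylinder
  have h₂ := isTetraChart_fullCylinder
  have f₁ := isFlowOfField_maximalFlow h₁.isOpen h₁.contDiffAt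
  have f₂ := isFlowOfField_maximalFlow h₂.isOpen h₂.contDiffAt
  refine ⟨⟨_, _, f₁, h₁.isTetraProjection, fun hφ => ?_, h₁.isExplicitJacobiFlow⟩,
    ⟨_, _, f₂, h₂.isTetraProjection, fun hφ => ?_, h₂.isExplicitJacobiFlow⟩⟩
  · -- at `(2, 0)` and `(1, 0)` homogeneity reads `2 √5 = 4 √2`
    have h := congrArg Prod.snd
      (hφ.field_smul f₁ (p := (1, 0)) two_ne_zero (mem_univ _) (mem_univ _))
    simp only [fieldPiTheta, Prod.smul_fst, Prod.smul_snd, smul_eq_mul] at h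
    have hsq := congrArg (· ^ 2) h
    simp only [mul_pow] at hsq
    rw [Real.sq_sqrt (by norm_num), Real.sq_sqrt (by norm_num)] at hsq
    norm_num at hsq
  · -- at `(2, 0)` and `(1, 0)` homogeneity reads `255 / 64 = 4 · 15 / 16`
    have h := congrArg Prod.snd
      (hφ.field_smul f₂ (p := (1, 0)) (s := 2) two_ne_zero (by simp) (by simp))
    simp only [fieldPiThetaHat, Prod.smul_fst, Prod.smul_snd, smul_eq_mul] at h
    norm_num at h
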